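/- A planar convex body is a compact convex set $\Omega\subset\mathbb R^2$ with nonempty interior; $\mathcal K^2$ denotes the class of all of them. For a Lebesgue measurable set $E\subset\mathbb R^2$ let $|E|$ be its area and $$P(E)=\sup\Big\{\int_E \operatorname{div}\varphi\,dx:\ \varphi\in C^1_c(\mathbb R^2;\mathbb R^2),\ \|\varphi(x)\|\le 1 \text{ for all } x\Big\}$$ its perimeter in the sense of De Giorgi. The Cheeger constant of $\Omega\in\mathcal K^2$ is $$h(\Omega)=\inf\Big\{\frac{P(E)}{|E|}:\ E\subseteq\Omega \text{ measurable},\ |E|>0\Big\}.$$ Let $d(\Omega)$ be the diameter of $\Omega$, $r(\Omega)=\sup_{x\in\Omega}\operatorname{dist}(x,\partial\Omega)$ the inradius, $R(\Omega)=\min_{x\in\Omega}\max_{y\in\partial\Omega}\|x-y\|$ the circumradius, and $\omega(\Omega)=\min_{\|y\|=1}\big(p_\Omega(y)+p_\Omega(-y)\big)$ the minimal width, where $p_\Omega(y)=\max_{x\in\Omega}x\cdot y$. Theorem. Let all the parameters $P,r,d,R,\omega,A$ below be positive real numbers. In each of the following thirteen classes the Cheeger constant $h$ attains both its minimum and its maximum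 (in particular each class is nonempty): 1. $\{\Omega\in\mathcal K^2: P(\Omega)=P,\ r(\Omega)=r\}$, where $P\ge 2\pi r$; 2. $\{\Omega\in\mathcal K^2: d(\Omega)=d,\ r(\Omega)=r\}$, where $d\ge 2r$; 3. $\{\Omega\in\mathcal K^2: R(\Omega)=R,\ r(\Omega)=r\}$, where $R\ge r$; 4. $\{\Omega\in\mathcal K^2: \omega(\Omega)=\omega,\ d(\Omega)=d\}$, where $\omega\le d$; 5. $\{\Omega\in\mathcal K^2: \omega(\Omega)=\omega,\ R(\Omega)=R\}$, where $\omega\le 2R$; 6. $\{\Omega\in\mathcal K^2: \omega(\Omega)=\omega,\ P(\Omega)=P\}$, where $P\ge \pi\omega$; 7. $\{\Omega\in\mathcal K^2: \omega(\Omega)=\omega,\ |\Omega|=A\}$, where $\sqrt3\,A\ge \omega^2$; 8. $\{\Omega\in\mathcal K^2: R(\Omega)=R,\ d(\Omega)=d\}$, where $\sqrt3\,R\le d<2R$; 9. $\{\Omega\in\mathcal K^2: \omega(\Omega)=\omega,\ r(\Omega)=r\}$, where $2r<\omega\le 3r$; 10. $\{\Omega\in\mathcal K^2: R(\Omega)=R,\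 |\Omega|=A\}$, where $A\le \pi R^2$; 11. $\{\Omega\in\mathcal K^2: P(\Omega)=P,\ R(\Omega)=R\}$, where $4R<P\le 2\pi R$; 12. $\{\Omega\in\mathcal K^2: P(\Omega)=P,\ d(\Omega)=d\}$, where $2d<P\le \pi d$; 13. $\{\Omega\in\mathcal K^2: d(\Omega)=d,\ |\Omega|=A\}$, where $\pi d^2\ge 4A$. -/

import Mathlib

open MeasureTheory

namespace PlanarCheeger

/-- The Euclidean plane. -/
abbrev Plane : Type := EuclideanSpace ℝ (Fin 2)

/-- The class of planar convex bodies: compact convex sets with nonempty interior. -/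
def convexBodies : Set (Set Plane) :=
  {Ω | IsCompact Ω ∧ Convex ℝ Ω ∧ (interior Ω).Nonempty}

/-- The divergence of a vector field on the plane. -/
noncomputable def divergence (φ : Plane → Plane) (x : Plane) : ℝ :=
  ∑ i : Fin 2, (fderiv ℝ φ x (EuclideanSpace.single i 1)) i

/-- The admissible fields in the definition of the De Giorgi perimeter: compactly supported
`C¹` vector fields of Euclidean norm at most one. -/
def testFields : Set (Plane → Plane) :=
  {φ | ContDiff ℝ 1 φ ∧ HasCompactSupport φ ∧ ∀ x, ‖φ x‖ ≤ 1}

/-- The perimeter in the sense of De Giorgi, with values in `[0, ∞]`. (The zero field is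
admissible, so truncating negative integrals at zero does not change the supremum.) -/
noncomputable def perimeter (E : Set Plane) : ENNReal :=
  ⨆ φ ∈ testFields, ENNReal.ofReal (∫ x in E, divergence φ x)

/-- The Cheeger constant: the infimum of perimeter over area among the Lebesgue measurable
subsets of positive area. -/
noncomputable def cheeger (Ω : Set Plane) : ENNReal :=
  sInf {q | ∃ E : Set Plane, NullMeasurableSet E volume ∧ E ⊆ Ω ∧ 0 < volume E ∧
    q = perimeter E / volume E}

/-- The inradius: the largest distance to the boundary of a point of the set. -/
noncomputable def inradius (Ω : Set Plane) : ℝ :=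
  sSup ((fun x => Metric.infDist x (frontier Ω)) '' Ω)

/-- The circumradius: the minimum over the points `x` of the set of the largest distance from `x`
to a boundary point. -/
noncomputable def circumradius (Ω : Set Plane) : ℝ :=
  sInf ((fun x => sSup ((fun y => dist x y) '' frontier Ω)) '' Ω)

/-- The support function. -/
noncomputable def supportFunction (Ω : Set Plane) (y : Plane) : ℝ :=
  sSup ((fun x => inner ℝ x y) '' Ω)

/-- The minimal width: the minimum over the unit directions of the width. -/
noncomputable def minimalWidth (Ω : Set Plane) : ℝ :=
  sInf ((fun y => supportFunction Ω y + supportFunction Ω (-y)) '' Metric.sphere 0 1)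

/-- The Cheeger constant attains both its minimum and its maximum on the class `K`. -/
def CheegerAttainsMinAndMax (K : Set (Set Plane)) : Prop :=
  (∃ Ω ∈ K, IsMinOn cheeger K Ω) ∧ (∃ Ω ∈ K, IsMaxOn cheeger K Ω)

end PlanarCheeger

namespace PlanarCheeger

open Metric Set Filter Topology
open scoped Pointwise NNReal

/-! This is the direct method, with monotonicity and scaling in place of continuity. Inradius,
circumradius, diameter, minimal width, perimeter and area are all monotone under inclusion of convex
bodies, translation invariant and homogeneous of some degree. The Cheeger constant is antitone and
homogeneous of degree `-1` (`cheeger_le_of_subset_image_dilate`). Suppose that `K` and members of a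
sequence of bodies lie, up to translation, in `t` times one another for every `t > 1`. Then letting
`t` decrease to 1 carries prescribed parameter values over to `K`, and likewise limits of Cheeger
constants.

Such sandwiches come from Blaschke selection (`exists_limit_body`). If all bodies have bounded
diameter and contain discs of a common radius, put these discs at the origin and extract a Hausdorff
limit. The common disc turns Hausdorff closeness into inclusion up to a factor `t`. Each class
therefore needs only a uniform inner disc, a uniform diameter bound and one member.

The inner disc is given by the inradius, or follows from the dichotomy
`subset_rect_or_closedBall_subset`: a body lies in a thin rectangle along a diameter or contains a
disc. Thin rectangles are excluded by the width, by the area, by `P > 2d`, or by `2R > d`. The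
diameter is given, or bounded by `2R`, or controlled by area or perimeter once a disc is inside. For
width and inradius, `ω > 2r` is what prevents long bodies: a long one would contain a disc of radius
close to `ω / 2`.

Ten classes contain a barrel, a disc of radius `ρ` cut by a strip of half-width `s ≤ ρ`, for which
`d = 2ρ`, `R = ρ`, `r = s`, `ω = 2s`; perimeter and area are adjusted by an intermediate value
argument. The pairs width–area, width–inradius and circumradius–diameter use trapezoids and
isosceles triangles.

For the De Giorgi perimeter, monotonicity on convex bodies reduces to cutting by half-planes
(`perimeter_inter_halfPlane_le`), and upper bounds come from the area of thin outer shells. -/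

/-- The homothety with ratio `t` followed by the translation by `c`. -/
def dilate (c : Plane) (t : ℝ) (y : Plane) : Plane := c + t • y

/-- A set functional that, on convex bodies, is monotone, translation invariant and positively
homogeneous of degree `k`. -/
def HomogeneousMonotone (k : ℕ) (F : Set Plane → ENNReal) : Prop :=
  ∀ K ∈ convexBodies, ∀ Ω ∈ convexBodies, ∀ c : Plane, ∀ t : ℝ, 0 < t →
    K ⊆ dilate c t '' Ω → F K ≤ ENNReal.ofReal t ^ k * F Ω

/-! ### Elementary facts on convex bodies and homotheties -/

lemma norm_eq_one_of_mem_sphere {u : Plane} (hu : u ∈ sphere (0 : Plane) 1) : ‖u‖ = 1 := by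
  simpa using hu

lemma exists_unit : ∃ u : Plane, ‖u‖ = 1 :=
  ⟨EuclideanSpace.single 0 1, by simp⟩

lemma convexBodies.nonempty {K : Set Plane} (hK : K ∈ convexBodies) : K.Nonempty :=
  hK.2.2.mono interior_subset

lemma convexBodies.ne_univ {K : Set Plane} (hK : K ∈ convexBodies) : K ≠ univ := by
  rintro rfl
  exact noncompact_univ Plane hK.1

lemma convexBodies.frontier_nonempty {K : Set Plane} (hK : K ∈ convexBodies) :
    (frontier K).Nonempty :=
  nonempty_frontier_iff.2 ⟨convexBodies.nonempty hK, convexBodies.ne_univ hK⟩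

lemma mem_convexBodies_of_closedBall_subset {K : Set Plane} (hc : IsCompact K) (hx : Convex ℝ K)
    {x : Plane} {ρ : ℝ} (hρ : 0 < ρ) (h : closedBall x ρ ⊆ K) : K ∈ convexBodies :=
  ⟨hc, hx, x, interior_mono h (ball_subset_interior_closedBall (mem_ball_self hρ))⟩

lemma closedBall_subset_of_subset_image_dilate {x c : Plane} {ρ t : ℝ} (ht : 0 < t) {Ω : Set Plane}
    (h : closedBall x ρ ⊆ dilate c t '' Ω) : closedBall (t⁻¹ • (x - c)) (ρ / t) ⊆ Ω := by
  intro y hy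
  have : dilate c t y ∈ closedBall x ρ := by
    rw [mem_closedBall, dist_eq_norm] at hy ⊢
    have e : dilate c t y - x = t • (y - t⁻¹ • (x - c)) := by
      simp only [dilate, smul_sub, smul_inv_smul₀ ht.ne']
      abel
    rw [e, norm_smul, Real.norm_eq_abs, abs_of_pos ht]
    rw [le_div_iff₀ ht] at hy
    linarith
  obtain ⟨z, hz, e⟩ := h this
  have : z = y := by
    simp only [dilate, add_right_inj] at e
    exact smul_right_injective _ ht.ne' e
  exact this ▸ hz

/-! ### Inradius -/

lemma le_infDist_frontier {K : Set Plane} (hK : K ∈ convexBodies) {x : Plane} {ρ : ℝ}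
    (h : closedBall x ρ ⊆ K) : ρ ≤ infDist x (frontier K) := by
  rw [le_infDist (convexBodies.frontier_nonempty hK)]
  intro y hy
  by_contra! hlt
  have : y ∈ interior K := interior_mono h
    (ball_subset_interior_closedBall (by rwa [mem_ball, dist_comm]))
  exact hy.2 this

/-- A segment from `x` to a point outside `K` must meet the frontier, by connectedness. The meeting
point is at least as far from `x` as the other endpoint, so it is that endpoint, which then lies in
`K`. -/
lemma closedBall_infDist_subset {K : Set Plane} (hK : K ∈ convexBodies) {x : Plane} (hx : x ∈ K) :
    closedBall x (infDist x (frontier K)) ⊆ K := by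
  intro y hy
  by_contra hyK
  have hc : IsPreconnected (segment ℝ x y) := (convex_segment x y).isPreconnected
  obtain ⟨z, hz, hzf⟩ : (segment ℝ x y ∩ frontier K).Nonempty := by
    by_contra hne
    rw [not_nonempty_iff_eq_empty] at hne
    have h1 : segment ℝ x y ⊆ interior K ∪ Kᶜ := by
      intro w hw
      by_cases hwK : w ∈ K
      · left
        by_contra hwi
        exact hne.subset ⟨hw, subset_closure hwK, hwi⟩
      · exact Or.inr hwK
    have h2 := hc (interior K) Kᶜ isOpen_interior hK.1.isClosed.isOpen_compl h1
      ⟨x, left_mem_segment ℝ x y, (h1 (left_mem_segment ℝ x y)).resolve_right (fun h => h hx)⟩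
      ⟨y, right_mem_segment ℝ x y, hyK⟩
    obtain ⟨w, -, hw1, hw2⟩ := h2
    exact hw2 (interior_subset hw1)
  have hzK : z ∈ K := hK.1.isClosed.frontier_subset hzf
  have hle : infDist x (frontier K) ≤ dist x z := infDist_le_dist_of_mem hzf
  rw [mem_closedBall, dist_comm] at hy
  have hadd : dist x z + dist z y = dist x y := dist_add_dist_of_mem_segment hz
  have : dist z y = 0 := le_antisymm (by linarith) dist_nonneg
  exact hyK (dist_eq_zero.1 this ▸ hzK)

lemma exists_closedBall_inradius {K : Set Plane} (hK : K ∈ convexBodies) :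
    ∃ x, closedBall x (inradius K) ⊆ K := by
  obtain ⟨x, hx, e⟩ := hK.1.exists_sSup_image_eq (convexBodies.nonempty hK)
    (continuous_infDist_pt (frontier K)).continuousOn
  exact ⟨x, by rw [inradius, e]; exact closedBall_infDist_subset hK hx⟩

lemma le_inradius {K : Set Plane} (hK : K ∈ convexBodies) {x : Plane} {ρ : ℝ} (hρ : 0 ≤ ρ)
    (h : closedBall x ρ ⊆ K) : ρ ≤ inradius K :=
  (le_infDist_frontier hK h).trans
    (le_csSup (hK.1.image (continuous_infDist_pt (frontier K))).bddAbove
      ⟨x, h (mem_closedBall_self hρ), rfl⟩)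

lemma inradius_nonneg (K : Set Plane) : 0 ≤ inradius K :=
  Real.sSup_nonneg (by rintro _ ⟨x, -, rfl⟩; exact infDist_nonneg)

lemma inradius_eq {K : Set Plane} (hK : K ∈ convexBodies) {x : Plane} {r : ℝ} (hr : 0 ≤ r)
    (h : closedBall x r ⊆ K) (h' : ∀ y ρ, 0 ≤ ρ → closedBall y ρ ⊆ K → ρ ≤ r) :
    inradius K = r := by
  obtain ⟨y, hy⟩ := exists_closedBall_inradius hK
  exact le_antisymm (h' y _ (inradius_nonneg K) hy) (le_inradius hK hr h)

lemma homogeneousMonotone_inradius :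
    HomogeneousMonotone 1 (fun K => ENNReal.ofReal (inradius K)) := by
  intro K hK Ω hΩ c t ht h
  obtain ⟨x, hx⟩ := exists_closedBall_inradius hK
  have := le_inradius hΩ (div_nonneg (inradius_nonneg K) ht.le)
    (closedBall_subset_of_subset_image_dilate ht (hx.trans h))
  rw [pow_one, ← ENNReal.ofReal_mul ht.le]
  apply ENNReal.ofReal_le_ofReal
  rwa [div_le_iff₀' ht] at this

/-! ### Circumradius -/

/-- A point of `K` farthest from `x` cannot be interior, since it could be pushed radially outwards.
Hence the maximum over the frontier in the definition of the circumradius is a maximum over `K`. -/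
lemma sSup_dist_frontier {K : Set Plane} (hK : K ∈ convexBodies) (x : Plane) :
    ∃ y ∈ frontier K, sSup ((fun y => dist x y) '' frontier K) = dist x y ∧
      K ⊆ closedBall x (dist x y) := by
  obtain ⟨y, hy, hmax⟩ := hK.1.exists_isMaxOn (convexBodies.nonempty hK)
    (continuous_const.dist continuous_id : Continuous fun y => dist x y).continuousOn
  have hyf : y ∈ frontier K := by
    refine ⟨subset_closure hy, fun hyi => ?_⟩
    obtain ⟨ε, hε, hb⟩ := Metric.isOpen_iff.1 isOpen_interior y hyi
    -- The outward direction is radial; if `y = x`, any unit vector serves.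
    obtain ⟨u, hu, hn⟩ : ∃ u : Plane, ‖u‖ = 1 ∧ y - x = ‖y - x‖ • u := by
      by_cases h0 : y - x = 0
      · obtain ⟨u, hu⟩ := exists_unit
        exact ⟨u, hu, by simp [h0]⟩
      · have h0' : ‖y - x‖ ≠ 0 := norm_ne_zero_iff.2 h0
        exact ⟨‖y - x‖⁻¹ • (y - x), by simp [norm_smul, h0'], by simp [smul_smul, h0']⟩
    have hm : y + (ε / 2) • u ∈ K := by
      apply interior_subset (hb _)
      rw [mem_ball, dist_eq_norm, add_sub_cancel_left, norm_smul, hu, Real.norm_eq_abs,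
        abs_of_pos (by positivity)]
      linarith
    have h1 : dist x (y + (ε / 2) • u) ≤ dist x y := hmax hm
    rw [dist_comm, dist_comm x y, dist_eq_norm, dist_eq_norm] at h1
    have e : y + (ε / 2) • u - x = (‖y - x‖ + ε / 2) • u := by
      rw [add_smul, ← hn]; abel
    rw [e, norm_smul, hu, Real.norm_eq_abs, abs_of_pos (by positivity)] at h1
    linarith
  refine ⟨y, hyf, ?_, fun z hz => ?_⟩
  · apply IsGreatest.csSup_eq
    refine ⟨⟨y, hyf, rfl⟩, ?_⟩
    rintro _ ⟨z, hz, rfl⟩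
    exact hmax (hK.1.isClosed.frontier_subset hz)
  · rw [mem_closedBall, dist_comm]
    exact hmax hz

lemma exists_nearest_point {K : Set Plane} (hK : IsClosed K) (hc : Convex ℝ K) (hne : K.Nonempty)
    (x : Plane) : ∃ y ∈ K, ∀ w ∈ K, inner ℝ (x - y) (w - y) ≤ 0 := by
  obtain ⟨y, hy, e⟩ := exists_norm_eq_iInf_of_complete_convex hne hK.isComplete hc x
  exact ⟨y, hy, (norm_eq_iInf_iff_real_inner_le_zero hc hy).1 e⟩

lemma circumradius_bddBelow (K : Set Plane) :
    BddBelow ((fun x => sSup ((fun y => dist x y) '' frontier K)) '' K) := by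
  refine ⟨0, ?_⟩
  rintro _ ⟨x, -, rfl⟩
  exact Real.sSup_nonneg (by rintro _ ⟨y, -, rfl⟩; exact dist_nonneg)

/-- The definition only admits centres in `K`. An arbitrary centre may be replaced by its nearest
point in `K`, which is no farther from any point of `K`. -/
lemma circumradius_le {K : Set Plane} (hK : K ∈ convexBodies) {z : Plane} {ρ : ℝ}
    (h : K ⊆ closedBall z ρ) : circumradius K ≤ ρ := by
  obtain ⟨x, hx, hproj⟩ :=
    exists_nearest_point hK.1.isClosed hK.2.1 (convexBodies.nonempty hK) z
  refine (csInf_le (circumradius_bddBelow K) ⟨x, hx, rfl⟩).trans ?_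
  obtain ⟨y, hy, e, -⟩ := sSup_dist_frontier hK x
  have hyK := hK.1.isClosed.frontier_subset hy
  have h1 := h hyK
  simp only [e]
  rw [mem_closedBall] at h1
  refine le_trans ?_ h1
  rw [dist_comm, dist_eq_norm, dist_eq_norm]
  have h2 := hproj y hyK
  have h3 : ‖y - z‖ ^ 2 = ‖y - x‖ ^ 2 - 2 * inner ℝ (y - x) (z - x) + ‖z - x‖ ^ 2 := by
    rw [← norm_sub_sq_real]; congr 2; abel
  rw [real_inner_comm] at h2
  exact abs_le_of_sq_le_sq' (by nlinarith [sq_nonneg ‖z - x‖]) (norm_nonneg _) |>.2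

lemma exists_subset_closedBall_of_circumradius_lt {K : Set Plane} (hK : K ∈ convexBodies) {ρ : ℝ}
    (h : circumradius K < ρ) : ∃ z, K ⊆ closedBall z ρ := by
  obtain ⟨_, ⟨x, hx, rfl⟩, hlt⟩ := exists_lt_of_csInf_lt ((convexBodies.nonempty hK).image _) h
  obtain ⟨y, -, e, hsub⟩ := sSup_dist_frontier hK x
  simp only [e] at hlt
  exact ⟨x, hsub.trans (closedBall_subset_closedBall hlt.le)⟩

lemma circumradius_nonneg (K : Set Plane) : 0 ≤ circumradius K :=
  Real.sInf_nonneg (by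
    rintro _ ⟨x, -, rfl⟩
    exact Real.sSup_nonneg (by rintro _ ⟨y, -, rfl⟩; exact dist_nonneg))

lemma circumradius_eq {K : Set Plane} (hK : K ∈ convexBodies) {x : Plane} {R : ℝ}
    (h : K ⊆ closedBall x R) (h' : ∀ z ρ, K ⊆ closedBall z ρ → R ≤ ρ) : circumradius K = R := by
  refine le_antisymm (circumradius_le hK h) (le_of_forall_gt fun ρ hρ => ?_)
  obtain ⟨ρ', h1, h2⟩ := exists_between hρ
  obtain ⟨z, hz⟩ := exists_subset_closedBall_of_circumradius_lt hK h1
  exact (h' z ρ' hz).trans_lt h2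

lemma image_dilate_subset_closedBall {Ω : Set Plane} {c z : Plane} {t ρ : ℝ} (ht : 0 < t)
    (h : Ω ⊆ closedBall z ρ) : dilate c t '' Ω ⊆ closedBall (dilate c t z) (t * ρ) := by
  rintro _ ⟨y, hy, rfl⟩
  have := h hy
  rw [mem_closedBall] at this ⊢
  simp only [dilate, dist_add_left, dist_smul₀, Real.norm_eq_abs, abs_of_pos ht]
  gcongr

lemma homogeneousMonotone_circumradius :
    HomogeneousMonotone 1 (fun K => ENNReal.ofReal (circumradius K)) := by
  intro K hK Ω hΩ c t ht h
  rw [pow_one, ← ENNReal.ofReal_mul ht.le]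
  apply ENNReal.ofReal_le_ofReal
  rw [← div_le_iff₀' ht]
  refine le_of_forall_gt fun ρ hρ => ?_
  obtain ⟨ρ', h1, h2⟩ := exists_between hρ
  obtain ⟨z, hz⟩ := exists_subset_closedBall_of_circumradius_lt hΩ h1
  have := circumradius_le hK (h.trans (image_dilate_subset_closedBall ht hz))
  rw [← div_le_iff₀' ht] at this
  exact this.trans_lt h2

/-! ### Diameter -/

lemma homogeneousMonotone_diam :
    HomogeneousMonotone 1 (fun K => ENNReal.ofReal (diam K)) := by
  intro K hK Ω hΩ c t ht h
  rw [pow_one, ← ENNReal.ofReal_mul ht.le]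
  apply ENNReal.ofReal_le_ofReal
  refine diam_le_of_forall_dist_le (mul_nonneg ht.le diam_nonneg) fun x hx y hy => ?_
  obtain ⟨x', hx', rfl⟩ := h hx
  obtain ⟨y', hy', rfl⟩ := h hy
  simp only [dilate, dist_add_left, dist_smul₀, Real.norm_eq_abs, abs_of_pos ht]
  gcongr
  exact dist_le_diam_of_mem hΩ.1.isBounded hx' hy'

lemma exists_dist_eq_diam {K : Set Plane} (hK : K ∈ convexBodies) :
    ∃ a ∈ K, ∃ b ∈ K, dist a b = diam K ∧ 0 < diam K := by
  have hne := convexBodies.nonempty hK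
  obtain ⟨⟨a, b⟩, ⟨ha, hb⟩, hmax⟩ := (hK.1.prod hK.1).exists_isMaxOn (hne.prod hne)
    (f := fun p : Plane × Plane => dist p.1 p.2) (by fun_prop)
  have e : dist a b = diam K := by
    refine le_antisymm (dist_le_diam_of_mem hK.1.isBounded ha hb)
      (diam_le_of_forall_dist_le dist_nonneg fun x hx y hy => ?_)
    exact isMaxOn_iff.1 hmax (x, y) ⟨hx, hy⟩
  refine ⟨a, ha, b, hb, e, ?_⟩
  obtain ⟨x, hx⟩ := hK.2.2
  obtain ⟨ε, hε, hball⟩ := Metric.isOpen_iff.1 isOpen_interior x hx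
  obtain ⟨u, hu⟩ := exists_unit
  have h2 : x + (ε / 2) • u ∈ K := by
    apply interior_subset (hball _)
    rw [mem_ball, dist_eq_norm, add_sub_cancel_left, norm_smul, hu, Real.norm_eq_abs,
      abs_of_pos (by positivity)]
    linarith
  have := dist_le_diam_of_mem hK.1.isBounded h2 (interior_subset hx)
  rw [dist_eq_norm, add_sub_cancel_left, norm_smul, hu, Real.norm_eq_abs,
      abs_of_pos (by positivity)] at this
  linarith

/-! ### Minimal width -/

lemma continuous_supportFunction {K : Set Plane} (hK : IsCompact K) :
    Continuous (supportFunction K) := by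
  unfold supportFunction
  apply hK.continuous_sSup (f := fun y x => inner ℝ x y)
  exact continuous_snd.inner continuous_fst

lemma exists_supportFunction {K : Set Plane} (hK : K ∈ convexBodies) (u : Plane) :
    ∃ x ∈ K, supportFunction K u = inner ℝ x u ∧ ∀ y ∈ K, inner ℝ y u ≤ inner ℝ x u := by
  obtain ⟨x, hx, e, h⟩ := hK.1.exists_sSup_image_eq_and_ge (convexBodies.nonempty hK)
    (continuous_id.inner continuous_const : Continuous fun x : Plane => inner ℝ x u).continuousOn
  exact ⟨x, hx, e, h⟩

/-- The width of a convex body in a direction is attained by a pair of points. -/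
lemma exists_width_eq {K : Set Plane} (hK : K ∈ convexBodies) (u : Plane) :
    ∃ x ∈ K, ∃ y ∈ K, supportFunction K u + supportFunction K (-u) = inner ℝ (x - y) u ∧
      ∀ x' ∈ K, ∀ y' ∈ K, inner ℝ (x' - y') u ≤ inner ℝ (x - y) u := by
  obtain ⟨x, hx, ex, hx'⟩ := exists_supportFunction hK u
  obtain ⟨y, hy, ey, hy'⟩ := exists_supportFunction hK (-u)
  refine ⟨x, hx, y, hy, by rw [ex, ey, inner_sub_left, inner_neg_right]; ring, ?_⟩
  intro x' hx1 y' hy1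
  have h1 := hx' x' hx1
  have h2 := hy' y' hy1
  rw [inner_neg_right, inner_neg_right] at h2
  rw [inner_sub_left, inner_sub_left]
  linarith

lemma exists_minimalWidth_direction {K : Set Plane} (hK : K ∈ convexBodies) :
    ∃ u : Plane, ‖u‖ = 1 ∧ (∀ x ∈ K, ∀ y ∈ K, inner ℝ (x - y) u ≤ minimalWidth K) ∧
      ∀ v : Plane, ‖v‖ = 1 → ∃ x ∈ K, ∃ y ∈ K, minimalWidth K ≤ inner ℝ (x - y) v := by
  have hcont : Continuous fun y : Plane => supportFunction K y + supportFunction K (-y) :=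
    (continuous_supportFunction hK.1).add ((continuous_supportFunction hK.1).comp continuous_neg)
  obtain ⟨u₀, hu₀⟩ := exists_unit
  have hne : (sphere (0 : Plane) 1).Nonempty := ⟨u₀, by simp [hu₀]⟩
  obtain ⟨u, hu, e, hmin⟩ := (isCompact_sphere (0 : Plane) 1).exists_sInf_image_eq_and_le hne
    hcont.continuousOn
  refine ⟨u, norm_eq_one_of_mem_sphere hu, ?_, ?_⟩
  · intro x hx y hy
    obtain ⟨x', -, y', -, e', h⟩ := exists_width_eq hK u
    rw [minimalWidth, e, e']
    exact h x hx y hy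
  · intro v hv
    obtain ⟨x', hx', y', hy', e', -⟩ := exists_width_eq hK v
    refine ⟨x', hx', y', hy', ?_⟩
    rw [minimalWidth, e, ← e']
    exact hmin v (by simp [hv])

lemma le_minimalWidth {K : Set Plane} (hK : K ∈ convexBodies) {w : ℝ}
    (h : ∀ v : Plane, ‖v‖ = 1 → ∃ x ∈ K, ∃ y ∈ K, w ≤ inner ℝ (x - y) v) :
    w ≤ minimalWidth K := by
  obtain ⟨u₀, hu₀⟩ := exists_unit
  apply le_csInf
  · exact ⟨_, u₀, by simp [hu₀], rfl⟩
  · rintro _ ⟨v, hv, rfl⟩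
    obtain ⟨x, hx, y, hy, hw⟩ := h v (norm_eq_one_of_mem_sphere hv)
    obtain ⟨x', -, y', -, e', h⟩ := exists_width_eq hK v
    simp only [e']
    exact hw.trans (h x hx y hy)

lemma minimalWidth_le {K : Set Plane} (hK : K ∈ convexBodies) {w : ℝ} {u : Plane} (hu : ‖u‖ = 1)
    (h : ∀ x ∈ K, ∀ y ∈ K, inner ℝ (x - y) u ≤ w) : minimalWidth K ≤ w := by
  obtain ⟨-, -, -, hv⟩ := exists_minimalWidth_direction hK
  obtain ⟨x, hx, y, hy, hw⟩ := hv u hu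
  exact hw.trans (h x hx y hy)

lemma minimalWidth_nonneg {K : Set Plane} (hK : K ∈ convexBodies) : 0 ≤ minimalWidth K := by
  obtain ⟨x, hx⟩ := convexBodies.nonempty hK
  exact le_minimalWidth hK fun v _ => ⟨x, hx, x, hx, by simp⟩

lemma homogeneousMonotone_minimalWidth :
    HomogeneousMonotone 1 (fun K => ENNReal.ofReal (minimalWidth K)) := by
  intro K hK Ω hΩ c t ht h
  rw [pow_one, ← ENNReal.ofReal_mul ht.le]
  apply ENNReal.ofReal_le_ofReal
  obtain ⟨u, hu, hw, -⟩ := exists_minimalWidth_direction hΩ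
  refine minimalWidth_le hK hu fun x hx y hy => ?_
  obtain ⟨x', hx', rfl⟩ := h hx
  obtain ⟨y', hy', rfl⟩ := h hy
  simp only [dilate, add_sub_add_left_eq_sub, ← smul_sub, real_inner_smul_left]
  gcongr
  exact hw x' hx' y' hy'

/-! ### Area -/

lemma volume_image_dilate (c : Plane) {t : ℝ} (ht : 0 < t) (E : Set Plane) :
    volume (dilate c t '' E) = ENNReal.ofReal t ^ 2 * volume E := by
  have : dilate c t '' E = (fun x => c + x) '' (t • E) := by
    rw [← image_smul, image_image]; rfl
  rw [this, image_add_left, measure_preimage_add, Measure.addHaar_smul]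
  simp [abs_of_pos ht, ENNReal.ofReal_pow ht.le]

lemma homogeneousMonotone_volume : HomogeneousMonotone 2 (fun K => volume K) := by
  intro K _ Ω _ c t ht h
  exact (measure_mono h).trans (volume_image_dilate c ht Ω).le

/-! ### The divergence -/

lemma continuous_divergence {φ : Plane → Plane} (hφ : ContDiff ℝ 1 φ) :
    Continuous (divergence φ) := by
  have h := hφ.continuous_fderiv (by norm_num)
  unfold divergence
  fun_prop

lemma sum_single_smul (v : Plane) : ∑ i : Fin 2, v i • EuclideanSpace.single i (1 : ℝ) = v := by
  ext j
  fin_cases j <;> simp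

lemma divergence_smul {χ : Plane → ℝ} {φ : Plane → Plane} {x : Plane}
    (hχ : DifferentiableAt ℝ χ x) (hφ : DifferentiableAt ℝ φ x) :
    divergence (fun y => χ y • φ y) x = χ x * divergence φ x + fderiv ℝ χ x (φ x) := by
  have e : fderiv ℝ χ x (φ x) = ∑ i : Fin 2, φ x i * fderiv ℝ χ x (EuclideanSpace.single i 1) := by
    conv_lhs => rw [← sum_single_smul (φ x)]
    simp
  rw [e]
  simp only [divergence, fderiv_fun_smul hχ hφ, Finset.mul_sum, ← Finset.sum_add_distrib]
  refine Finset.sum_congr rfl fun i _ => ?_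
  simp [mul_comm]

lemma divergence_add {φ ψ : Plane → Plane} {x : Plane}
    (hφ : DifferentiableAt ℝ φ x) (hψ : DifferentiableAt ℝ ψ x) :
    divergence (fun y => φ y + ψ y) x = divergence φ x + divergence ψ x := by
  simp [divergence, fderiv_fun_add hφ hψ, Finset.sum_add_distrib]

lemma divergence_const (v x : Plane) : divergence (fun _ => v) x = 0 := by
  simp [divergence]

lemma divergence_smul_const {χ : Plane → ℝ} {x v : Plane} (hχ : DifferentiableAt ℝ χ x) :
    divergence (fun y => χ y • v) x = fderiv ℝ χ x v := by
  rw [divergence_smul hχ (differentiableAt_const v), divergence_const, mul_zero, zero_add]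

lemma divergence_const_smul_id (a : ℝ) (x : Plane) :
    divergence (fun y => a • y) x = 2 * a := by
  have : ∀ v : Plane, fderiv ℝ (fun y : Plane => a • y) x v = a • v := by
    intro v
    have h : fderiv ℝ (fun y : Plane => a • y) x = _ := ((hasFDerivAt_id x).const_smul a).fderiv
    simp [h]
  simp [divergence, this]

lemma divergence_congr {φ ψ : Plane → Plane} {x : Plane} (h : φ =ᶠ[𝓝 x] ψ) :
    divergence φ x = divergence ψ x := by
  simp only [divergence, h.fderiv_eq]

lemma divergence_comp_dilate {φ : Plane → Plane} (hφ : Differentiable ℝ φ) (c : Plane) (t : ℝ)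
    (y : Plane) :
    divergence (fun y => φ (dilate c t y)) y = t * divergence φ (dilate c t y) := by
  have h1 : HasFDerivAt (dilate c t) (t • ContinuousLinearMap.id ℝ Plane) y := by
    unfold dilate
    exact ((hasFDerivAt_id y).const_smul t).const_add c
  have h2 := (hφ (dilate c t y)).hasFDerivAt.comp y h1
  have h3 : fderiv ℝ (fun y => φ (dilate c t y)) y = _ := h2.fderiv
  simp [divergence, h3]
  ring

/-! ### The perimeter -/

lemma le_perimeter {E : Set Plane} {φ : Plane → Plane} (hφ : φ ∈ testFields) :
    ENNReal.ofReal (∫ x in E, divergence φ x) ≤ perimeter E :=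
  le_iSup₂_of_le φ hφ le_rfl

lemma perimeter_le {E : Set Plane} {M : ENNReal}
    (h : ∀ φ ∈ testFields, ENNReal.ofReal (∫ x in E, divergence φ x) ≤ M) : perimeter E ≤ M :=
  iSup₂_le h

lemma integrableOn_of_continuous {E : Set Plane} (hE : Bornology.IsBounded E) {f : Plane → ℝ}
    (hf : Continuous f) : IntegrableOn f E :=
  (hf.continuousOn.integrableOn_compact hE.isCompact_closure).mono_set subset_closure

/-- For a bounded set, fields bounded by one near the set are admissible. -/
lemma le_perimeter_of_subset_closedBall {E : Set Plane} (hm : MeasurableSet E) {c : Plane}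
    {R R' : ℝ} (hR : 0 ≤ R) (hRR' : R < R') (hE : E ⊆ closedBall c R) {φ : Plane → Plane}
    (hφ : ContDiff ℝ 1 φ) (hb : ∀ x ∈ ball c R', ‖φ x‖ ≤ 1) :
    ENNReal.ofReal (∫ x in E, divergence φ x) ≤ perimeter E := by
  -- Radius `(R + R') / 2` leaves a neighbourhood of `E` where the cutoff is 1, so the divergence on
  -- `E` is unchanged, while the cutoff vanishes where `φ` may exceed norm one.
  let f : ContDiffBump c := ⟨(R + R') / 2, R', by linarith, by linarith⟩
  have hf : ContDiff ℝ 1 (f : Plane → ℝ) := f.contDiff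
  have hmem : (fun y => f y • φ y) ∈ testFields := by
    refine ⟨hf.smul hφ, f.hasCompactSupport.smul_right, fun x => ?_⟩
    by_cases hx : x ∈ ball c R'
    · rw [norm_smul, Real.norm_eq_abs, abs_of_nonneg f.nonneg]
      exact mul_le_one₀ f.le_one (norm_nonneg _) (hb x hx)
    · have : f x = 0 := f.zero_of_le_dist (by simpa using hx)
      simp [this]
  have e : ∫ x in E, divergence φ x = ∫ x in E, divergence (fun y => f y • φ y) x := by
    refine setIntegral_congr_fun hm fun x hx => ?_
    apply divergence_congr
    have hx' : x ∈ ball c f.rIn := by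
      have := hE hx
      rw [mem_closedBall] at this
      rw [mem_ball]
      show _ < (R + R') / 2
      linarith
    filter_upwards [isOpen_ball.mem_nhds hx'] with y hy
    rw [f.one_of_mem_closedBall (ball_subset_closedBall hy), one_smul]
  rw [e]
  exact le_perimeter hmem

lemma le_perimeter_of_isBounded {E : Set Plane} (hm : MeasurableSet E) (hE : Bornology.IsBounded E)
    {φ : Plane → Plane} (hφ : ContDiff ℝ 1 φ) (hb : ∀ x, ‖φ x‖ ≤ 1) :
    ENNReal.ofReal (∫ x in E, divergence φ x) ≤ perimeter E := by
  obtain ⟨R, hR, hE'⟩ := hE.subset_closedBall_lt 0 0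
  exact le_perimeter_of_subset_closedBall hm hR.le (lt_add_one R) hE' hφ fun x _ => hb x

lemma setIntegral_image_dilate (c : Plane) {t : ℝ} (ht : 0 < t) (E : Set Plane) (g : Plane → ℝ) :
    ∫ x in dilate c t '' E, g x = t ^ 2 * ∫ x in E, g (dilate c t x) := by
  have h1 : dilate c t '' E = (fun x => c + x) '' (t • E) := by
    rw [← image_smul, image_image]; rfl
  rw [h1, (measurePreserving_add_left volume c).setIntegral_image_emb
    (Homeomorph.addLeft c).measurableEmbedding]
  have h2 := Measure.setIntegral_comp_smul_of_pos volume (fun x => g (c + x)) E ht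
  simp only [finrank_euclideanSpace, Fintype.card_fin, smul_eq_mul] at h2
  simp only [dilate]
  rw [h2, mul_inv_cancel_left₀ (by positivity)]

/-- Test fields pull back to test fields; the divergence gains a factor `t` and the area element a
factor `t ^ 2`. -/
lemma perimeter_image_dilate_le (c : Plane) {t : ℝ} (ht : 0 < t) (E : Set Plane) :
    perimeter (dilate c t '' E) ≤ ENNReal.ofReal t * perimeter E := by
  refine perimeter_le fun φ hφ => ?_
  have hd : ContDiff ℝ 1 (dilate c t) := by unfold dilate; fun_prop
  have hmem : (fun y => φ (dilate c t y)) ∈ testFields := by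
    refine ⟨hφ.1.comp hd, ?_, fun x => hφ.2.2 _⟩
    exact hφ.2.1.comp_homeomorph
      ((Homeomorph.smulOfNeZero t ht.ne').trans (Homeomorph.addLeft c))
  have e : ∫ x in dilate c t '' E, divergence φ x
      = t * ∫ x in E, divergence (fun y => φ (dilate c t y)) x := by
    rw [setIntegral_image_dilate c ht]
    simp only [divergence_comp_dilate (hφ.1.differentiable (by norm_num)), integral_const_mul]
    ring
  rw [e, ENNReal.ofReal_mul ht.le]
  gcongr
  exact le_perimeter hmem

/-! ### Cutting by half-planes and by convex sets -/

lemma isClosed_halfPlane (n : Plane) (c : ℝ) : IsClosed {x : Plane | inner ℝ x n ≤ c} :=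
  isClosed_le (by fun_prop) continuous_const

/-- Beyond the cutting line, replace the test field by the constant unit normal `n`. The glued field
`(1 - χ) φ + χ n` is admissible on `E`, and its divergence is `(1 - χ) div φ + ∇χ · (n - φ)`. The
last term is nonnegative because `∇χ` is a nonnegative multiple of `n` and `φ · n ≤ 1`. -/
lemma perimeter_inter_halfPlane_le {E : Set Plane} (hm : MeasurableSet E)
    (hE : Bornology.IsBounded E) {n : Plane} (hn : ‖n‖ = 1) (c : ℝ) :
    perimeter (E ∩ {x | inner ℝ x n ≤ c}) ≤ perimeter E := by
  refine perimeter_le fun φ hφ => ?_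
  have hdiv := continuous_divergence hφ.1
  -- These cutoffs vanish on the half-plane, increase in the direction `n`, and tend pointwise to
  -- the indicator of its complement.
  let χ : ℕ → Plane → ℝ := fun k x => Real.smoothTransition ((k + 1) * (inner ℝ x n - c))
  have hχc : ∀ k, ContDiff ℝ 1 (χ k) := fun k => by
    exact Real.smoothTransition.contDiff.comp
      (contDiff_const.mul ((contDiff_id.inner ℝ contDiff_const).sub contDiff_const))
  have hχ0 : ∀ k x, 0 ≤ χ k x := fun k x => Real.smoothTransition.nonneg _
  have hχ1 : ∀ k x, χ k x ≤ 1 := fun k x => Real.smoothTransition.le_one _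
  have hfd : ∀ k x, ∃ s, 0 ≤ s ∧ ∀ v, fderiv ℝ (χ k) x v = s * inner ℝ v n := by
    intro k x
    have h1 : HasFDerivAt (fun x : Plane => ((k : ℝ) + 1) * (inner ℝ x n - c))
        (((k : ℝ) + 1) • innerSL ℝ n) x := by
      have : HasFDerivAt (fun x : Plane => inner ℝ x n - c) (innerSL ℝ n) x := by
        have e : (fun x : Plane => inner ℝ x n - c) = fun x => innerSL ℝ n x - c := by
          ext y
          simp [real_inner_comm]
        rw [e]
        exact (innerSL ℝ n).hasFDerivAt.sub_const c
      simpa using this.const_mul ((k : ℝ) + 1)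
    have h2 : DifferentiableAt ℝ Real.smoothTransition ((k + 1) * (inner ℝ x n - c)) :=
      (Real.smoothTransition.contDiff (n := 1)).differentiable (by norm_num) _
    have h3 := h2.hasDerivAt.comp_hasFDerivAt x h1
    refine ⟨deriv Real.smoothTransition ((k + 1) * (inner ℝ x n - c)) * (k + 1),
      mul_nonneg Real.smoothTransition.monotone.deriv_nonneg (by positivity), fun v => ?_⟩
    have h4 : fderiv ℝ (χ k) x = _ := h3.fderiv
    rw [h4]
    simp [real_inner_comm, mul_assoc]
  have key : ∀ k, ENNReal.ofReal (∫ x in E, (1 - χ k x) * divergence φ x) ≤ perimeter E := by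
    intro k
    have hc1 : ContDiff ℝ 1 fun x => (1 - χ k x) := contDiff_const.sub (hχc k)
    have hψ : ContDiff ℝ 1 fun x => (1 - χ k x) • φ x + χ k x • n :=
      (hc1.smul hφ.1).add ((hχc k).smul contDiff_const)
    refine le_trans (ENNReal.ofReal_le_ofReal ?_) (le_perimeter_of_isBounded hm hE hψ fun x => ?_)
    · apply setIntegral_mono
      · exact integrableOn_of_continuous hE (hc1.continuous.mul hdiv)
      · exact integrableOn_of_continuous hE (continuous_divergence hψ)
      · intro x
        have d0 : DifferentiableAt ℝ (χ k) x := (hχc k).differentiable (by norm_num) x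
        have d1 : DifferentiableAt ℝ (fun x => 1 - χ k x) x := d0.const_sub 1
        have d2 : DifferentiableAt ℝ φ x := hφ.1.differentiable (by norm_num) x
        simp only
        rw [divergence_add (d1.fun_smul d2) (d0.smul_const n), divergence_smul d1 d2,
          divergence_smul_const d0, fderiv_const_sub]
        obtain ⟨s, hs, h⟩ := hfd k x
        simp only [neg_apply, h, real_inner_self_eq_norm_sq, hn]
        have : inner ℝ (φ x) n ≤ 1 :=
          (real_inner_le_norm _ _).trans (by rw [hn, mul_one]; exact hφ.2.2 x)
        nlinarith
    · calc ‖(1 - χ k x) • φ x + χ k x • n‖ ≤ ‖(1 - χ k x) • φ x‖ + ‖χ k x • n‖ := norm_add_le _ _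
        _ = (1 - χ k x) * ‖φ x‖ + χ k x := by
          rw [norm_smul, norm_smul, hn, Real.norm_eq_abs, Real.norm_eq_abs,
            abs_of_nonneg (hχ0 k x), abs_of_nonneg (sub_nonneg.2 (hχ1 k x)), mul_one]
        _ ≤ 1 := by nlinarith [hφ.2.2 x, hχ1 k x]
  have hlim : Tendsto (fun k => ∫ x in E, (1 - χ k x) * divergence φ x) atTop
      (𝓝 (∫ x in E, ({x : Plane | inner ℝ x n ≤ c}).indicator (divergence φ) x)) := by
    apply tendsto_integral_of_dominated_convergence (fun x => |divergence φ x|)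
    · intro k
      exact ((continuous_const.sub (hχc k).continuous).mul hdiv).aestronglyMeasurable
    · exact integrableOn_of_continuous hE hdiv.abs
    · intro k
      refine Eventually.of_forall fun x => ?_
      rw [Real.norm_eq_abs, abs_mul, abs_of_nonneg (sub_nonneg.2 (hχ1 k x))]
      nlinarith [abs_nonneg (divergence φ x), hχ0 k x]
    · refine Eventually.of_forall fun x => ?_
      by_cases hx : inner ℝ x n ≤ c
      · have : ∀ k, χ k x = 0 := fun k => Real.smoothTransition.zero_of_nonpos
          (mul_nonpos_of_nonneg_of_nonpos (by positivity) (by linarith))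
        simp [this, indicator, hx]
      · rw [indicator_of_notMem (by simpa using hx)]
        apply tendsto_const_nhds.congr'
        push Not at hx
        obtain ⟨N, hN⟩ := exists_nat_ge (inner ℝ x n - c)⁻¹
        filter_upwards [eventually_ge_atTop N] with k hk
        have : χ k x = 1 := by
          apply Real.smoothTransition.one_of_one_le
          have h0 : 0 < inner ℝ x n - c := sub_pos.2 hx
          rw [← div_le_iff₀ h0, one_div]
          have : (N : ℝ) ≤ k := by exact_mod_cast hk
          linarith
        simp [this]
  rw [setIntegral_indicator (isClosed_halfPlane n c).measurableSet] at hlim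
  exact le_of_tendsto ((ENNReal.continuous_ofReal.tendsto _).comp hlim) (Eventually.of_forall key)

lemma perimeter_iInter_le {E : ℕ → Set Plane} (hm : ∀ k, MeasurableSet (E k)) (ha : Antitone E)
    (hE : Bornology.IsBounded (E 0)) {M : ENNReal} (h : ∀ k, perimeter (E k) ≤ M) :
    perimeter (⋂ k, E k) ≤ M := by
  refine perimeter_le fun φ hφ => ?_
  have := tendsto_setIntegral_of_antitone (μ := volume) hm ha
    ⟨0, integrableOn_of_continuous hE (continuous_divergence hφ.1)⟩
  exact le_of_tendsto ((ENNReal.continuous_ofReal.tendsto _).comp this)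
    (Eventually.of_forall fun k => (le_perimeter hφ).trans (h k))

lemma exists_separating_halfPlane {K : Set Plane} (hK : IsClosed K) (hc : Convex ℝ K)
    (hne : K.Nonempty) {x : Plane} (hx : x ∉ K) :
    ∃ n : Plane, ‖n‖ = 1 ∧ ∃ c : ℝ, c < inner ℝ x n ∧ ∀ y ∈ K, inner ℝ y n ≤ c := by
  obtain ⟨y, hy, h⟩ := exists_nearest_point hK hc hne x
  have h0 : 0 < ‖x - y‖ := norm_pos_iff.2 (sub_ne_zero.2 fun e => hx (e ▸ hy))
  refine ⟨‖x - y‖⁻¹ • (x - y), by simp [norm_smul, h0.ne'],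
    inner ℝ y (‖x - y‖⁻¹ • (x - y)), ?_, fun w hw => ?_⟩
  · rw [← sub_pos, ← inner_sub_left, real_inner_smul_right, real_inner_self_eq_norm_sq]
    positivity
  · rw [← sub_nonpos, ← inner_sub_left, real_inner_smul_right, real_inner_comm]
    exact mul_nonpos_of_nonneg_of_nonpos (by positivity) (h w hw)

/-- The complement is a union of open half-planes by separation, and the Lindelöf property leaves
countably many of them. -/
lemma exists_seq_halfPlanes {K : Set Plane} (hK : IsClosed K) (hc : Convex ℝ K)
    (hne : K.Nonempty) (huniv : K ≠ univ) :
    ∃ n : ℕ → Plane, ∃ c : ℕ → ℝ, (∀ k, ‖n k‖ = 1) ∧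
      K = ⋂ k, {x : Plane | inner ℝ x (n k) ≤ c k} := by
  let I : Set (Plane × ℝ) := {p | ‖p.1‖ = 1 ∧ ∀ y ∈ K, inner ℝ y p.1 ≤ p.2}
  let s : I → Set Plane := fun p => {x | inner ℝ x p.1.1 ≤ p.1.2}ᶜ
  have hU : ⋃ p, s p = Kᶜ := by
    ext x
    simp only [mem_iUnion, s, mem_compl_iff]
    constructor
    · rintro ⟨p, hp⟩ hx
      exact hp (p.2.2 x hx)
    · intro hx
      obtain ⟨n, hn, c, hlt, hle⟩ := exists_separating_halfPlane hK hc hne hx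
      exact ⟨⟨(n, c), hn, hle⟩, by simpa using hlt⟩
  obtain ⟨T, hT, hTU⟩ := TopologicalSpace.isOpen_iUnion_countable s
    fun p => (isClosed_halfPlane _ _).isOpen_compl
  -- Enumerating by `ℕ` needs a nonempty family; an empty one would force `K = univ`.
  have hTne : T.Nonempty := by
    rw [nonempty_iff_ne_empty]
    rintro rfl
    rw [hU] at hTU
    simp only [mem_empty_iff_false, iUnion_of_empty, iUnion_empty] at hTU
    exact huniv (compl_empty_iff.1 hTU.symm)
  obtain ⟨f, hf⟩ := hT.exists_eq_range hTne
  refine ⟨fun k => (f k).1.1, fun k => (f k).1.2, fun k => (f k).2.1, ?_⟩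
  rw [← compl_inj_iff, ← hU, ← hTU, compl_iInter, hf, biUnion_range]

/-- Intersecting a bounded set with a closed convex set does not increase the perimeter. -/
lemma perimeter_inter_convex_le {E K : Set Plane} (hm : MeasurableSet E)
    (hE : Bornology.IsBounded E) (hK : IsClosed K) (hc : Convex ℝ K) (hne : K.Nonempty) :
    perimeter (E ∩ K) ≤ perimeter E := by
  by_cases huniv : K = univ
  · simp [huniv]
  obtain ⟨n, c, hn, hKeq⟩ := exists_seq_halfPlanes hK hc hne huniv
  -- Cut by one more half-plane at a time; the sets decrease to `E ∩ K`, and a perimeter bound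
  -- survives decreasing intersections.
  let F : ℕ → Set Plane := fun k => E ∩ ⋂ j ∈ Finset.range k, {x : Plane | inner ℝ x (n j) ≤ c j}
  have hFs : ∀ k, F (k + 1) = F k ∩ {x : Plane | inner ℝ x (n k) ≤ c k} := by
    intro k
    simp only [F, Finset.range_add_one, Finset.set_biInter_insert]
    rw [inter_assoc, inter_comm {x : Plane | inner ℝ x (n k) ≤ c k}]
  have hFE : ∀ k, F k ⊆ E := fun k => inter_subset_left
  have hFm : ∀ k, MeasurableSet (F k) := fun k =>
    hm.inter (Finset.measurableSet_biInter _ fun j _ => (isClosed_halfPlane _ _).measurableSet)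
  have hF0 : F 0 = E := by simp [F]
  have hFa : Antitone F := antitone_nat_of_succ_le fun k => by
    rw [hFs]; exact inter_subset_left
  have hP : ∀ k, perimeter (F k) ≤ perimeter E := by
    intro k
    induction k with
    | zero => rw [hF0]
    | succ k ih =>
      rw [hFs]
      exact (perimeter_inter_halfPlane_le (hFm k) (hE.subset (hFE k)) (hn k) _).trans ih
  have e : E ∩ K = ⋂ k, F k := by
    ext x
    simp only [hKeq, F, mem_inter_iff, mem_iInter, Finset.mem_range]
    exact ⟨fun h k => ⟨h.1, fun j _ => h.2 j⟩, fun h => ⟨(h 0).1, fun k => (h (k + 1)).2 k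
      (Nat.lt_succ_self k)⟩⟩
  rw [e]
  exact perimeter_iInter_le hFm hFa (hF0 ▸ hE) hP

lemma perimeter_mono_of_convex {K E : Set Plane} (hK : IsClosed K) (hc : Convex ℝ K)
    (hne : K.Nonempty) (hm : MeasurableSet E) (hE : Bornology.IsBounded E) (h : K ⊆ E) :
    perimeter K ≤ perimeter E := by
  have := perimeter_inter_convex_le hm hE hK hc hne
  rwa [inter_eq_self_of_subset_right h] at this

lemma continuous_dilate (c : Plane) (t : ℝ) : Continuous (dilate c t) := by
  unfold dilate; fun_prop

lemma homogeneousMonotone_perimeter : HomogeneousMonotone 1 perimeter := by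
  intro K hK Ω hΩ c t ht h
  have hcomp : IsCompact (dilate c t '' Ω) := hΩ.1.image (continuous_dilate c t)
  rw [pow_one]
  exact (perimeter_mono_of_convex hK.1.isClosed hK.2.1 (convexBodies.nonempty hK)
    hcomp.measurableSet hcomp.isBounded h).trans (perimeter_image_dilate_le c ht Ω)

/-! ### The Cheeger constant -/

lemma image_dilate_eq_preimage (c : Plane) {t : ℝ} (ht : 0 < t) (E : Set Plane) :
    dilate (-(t⁻¹ • c)) t⁻¹ '' E = dilate c t ⁻¹' E := by
  have h1 : ∀ y, dilate c t (dilate (-(t⁻¹ • c)) t⁻¹ y) = y := fun y => by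
    simp [dilate, smul_add, smul_smul, ht.ne']
  have h2 : ∀ y, dilate (-(t⁻¹ • c)) t⁻¹ (dilate c t y) = y := fun y => by
    simp [dilate, smul_add, smul_smul, ht.ne']
  exact congrFun (image_eq_preimage_of_inverse h1 h2) E

/-- The inverse homothety carries a competitor `E` in `K` to a competitor in `Ω`, multiplying its
ratio of perimeter to area by `t`. -/
lemma cheeger_le_of_subset_image_dilate {K Ω : Set Plane} {c : Plane} {t : ℝ} (ht : 0 < t)
    (h : K ⊆ dilate c t '' Ω) : cheeger Ω ≤ ENNReal.ofReal t * cheeger K := by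
  have ht0 : ENNReal.ofReal t ≠ 0 := by simpa using ht
  rw [mul_comm, ← ENNReal.div_le_iff_le_mul (Or.inl ht0) (Or.inl ENNReal.ofReal_ne_top)]
  refine le_sInf ?_
  rintro _ ⟨E, hE, hEK, hpos, rfl⟩
  have hv := volume_image_dilate (-(t⁻¹ • c)) (inv_pos.2 ht) E
  have hp := perimeter_image_dilate_le (-(t⁻¹ • c)) (inv_pos.2 ht) E
  have hpos' : 0 < volume (dilate (-(t⁻¹ • c)) t⁻¹ '' E) := by
    rw [hv]
    exact ENNReal.mul_pos (by positivity) hpos.ne'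
  have hnm : NullMeasurableSet (dilate (-(t⁻¹ • c)) t⁻¹ '' E) volume := by
    rw [image_dilate_eq_preimage c ht]
    refine hE.preimage ⟨(continuous_dilate c t).measurable, ?_⟩
    refine Measure.AbsolutelyContinuous.mk fun s hs h0 => ?_
    rw [Measure.map_apply (continuous_dilate c t).measurable hs, ← image_dilate_eq_preimage c ht,
      volume_image_dilate _ (inv_pos.2 ht), h0, mul_zero]
  have hsub : dilate (-(t⁻¹ • c)) t⁻¹ '' E ⊆ Ω := by
    rw [image_dilate_eq_preimage c ht]
    intro y hy
    obtain ⟨z, hz, e⟩ := h (hEK hy)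
    have : z = y := by
      simp only [dilate, add_right_inj] at e
      exact smul_right_injective _ ht.ne' e
    exact this ▸ hz
  have hle : cheeger Ω ≤ perimeter (dilate (-(t⁻¹ • c)) t⁻¹ '' E) /
      volume (dilate (-(t⁻¹ • c)) t⁻¹ '' E) := sInf_le ⟨_, hnm, hsub, hpos', rfl⟩
  rw [ENNReal.div_le_iff_le_mul (Or.inl ht0) (Or.inl ENNReal.ofReal_ne_top)]
  refine hle.trans ?_
  rw [hv]
  refine (ENNReal.div_le_div_right hp _).trans ?_
  rw [ENNReal.ofReal_inv_of_pos ht]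
  set T := ENNReal.ofReal t
  have hT : T ≠ ⊤ := ENNReal.ofReal_ne_top
  rw [div_eq_mul_inv, div_eq_mul_inv, ENNReal.mul_inv (Or.inl (by simp [hT]))
    (Or.inl (by simp [ht0])), ← ENNReal.inv_pow, inv_inv]
  have : T⁻¹ * perimeter E * (T ^ 2 * (volume E)⁻¹)
      = (T⁻¹ * T) * (perimeter E * (volume E)⁻¹ * T) := by ring
  rw [this, ENNReal.inv_mul_cancel ht0 hT, one_mul]

/-! ### An upper bound for the perimeter by the area of thin shells -/

/-- Integrate by parts coordinatewise: the integral becomes that of `-∇χ · φ`. By Rademacher `∇χ`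
exists almost everywhere; it has norm at most `C` on `S` and vanishes at the local extrema outside
`S`. -/
lemma integral_lipschitz_mul_divergence_le {χ : Plane → ℝ} {C : ℝ≥0} (hχ : LipschitzWith C χ)
    {S : Set Plane} (hS : MeasurableSet S) (hSv : volume S ≠ ⊤)
    (hext : ∀ x ∉ S, IsLocalExtr χ x) {φ : Plane → Plane} (hφ : φ ∈ testFields) :
    ∫ x, χ x * divergence φ x ≤ C * volume.real S := by
  have hcomp : ∀ i : Fin 2, ContDiff ℝ 1 fun x => φ x i := fun i =>
    (contDiff_piLp_apply (p := 2) (i := i)).comp hφ.1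
  have hsupp : ∀ i : Fin 2, HasCompactSupport fun x => φ x i := fun i =>
    hφ.2.1.comp_left (g := fun v : Plane => v i) rfl
  have hfd : ∀ (i : Fin 2) x v, fderiv ℝ (fun x => φ x i) x v = fderiv ℝ φ x v i := by
    intro i x v
    have h1 := (hφ.1.differentiable (by norm_num) x).hasFDerivAt
    have h2 : fderiv ℝ (fun x => φ x i) x = _ :=
      ((EuclideanSpace.proj i : Plane →L[ℝ] ℝ).hasFDerivAt.comp x h1).fderiv
    rw [h2]
    rfl
  have hparts : ∀ i : Fin 2,
      ∫ x, χ x * fderiv ℝ φ x (EuclideanSpace.single i 1) i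
        = ∫ x, lineDeriv ℝ χ x (-EuclideanSpace.single i 1) * φ x i := by
    intro i
    obtain ⟨D, hD⟩ := (hcomp i).lipschitzWith_of_hasCompactSupport (hsupp i) (by norm_num)
    rw [hχ.integral_lineDeriv_mul_eq hD (hsupp i), neg_neg]
    refine integral_congr_ae (Eventually.of_forall fun x => ?_)
    simp only
    rw [((hcomp i).differentiable (by norm_num) x).lineDeriv_eq_fderiv, hfd, mul_comm]
  have hint : ∀ i : Fin 2,
      Integrable fun x => lineDeriv ℝ χ x (-EuclideanSpace.single i 1) * φ x i := fun i =>
    ((hcomp i).continuous.integrable_of_hasCompactSupport (hsupp i)).mul_of_top_right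
      (hχ.memLp_lineDeriv _)
  have hint' : ∀ i : Fin 2,
      Integrable fun x => χ x * fderiv ℝ φ x (EuclideanSpace.single i 1) i := by
    intro i
    have hc : Continuous fun x => fderiv ℝ φ x (EuclideanSpace.single i 1) i := by
      have := hφ.1.continuous_fderiv (by norm_num)
      fun_prop
    refine (hχ.continuous.mul hc).integrable_of_hasCompactSupport (HasCompactSupport.mul_left ?_)
    exact (hφ.2.1.fderiv (𝕜 := ℝ)).comp_left
      (g := fun L : Plane →L[ℝ] Plane => L (EuclideanSpace.single i 1) i) rfl
  have e : ∫ x, χ x * divergence φ x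
      = ∫ x, ∑ i : Fin 2, lineDeriv ℝ χ x (-EuclideanSpace.single i 1) * φ x i := by
    rw [integral_finsetSum _ fun i _ => hint i]
    simp only [← hparts]
    rw [← integral_finsetSum _ fun i _ => hint' i]
    simp only [divergence, Finset.mul_sum]
  rw [e]
  have hbound : ∀ᵐ x, ∑ i : Fin 2, lineDeriv ℝ χ x (-EuclideanSpace.single i 1) * φ x i
      ≤ S.indicator (fun _ => (C : ℝ)) x := by
    filter_upwards [hχ.ae_differentiableAt] with x hx
    have e2 : ∑ i : Fin 2, lineDeriv ℝ χ x (-EuclideanSpace.single i 1) * φ x i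
        = -fderiv ℝ χ x (φ x) := by
      conv_rhs => rw [← sum_single_smul (φ x)]
      simp [hx.lineDeriv_eq_fderiv]
      ring
    rw [e2]
    by_cases hxS : x ∈ S
    · rw [indicator_of_mem hxS]
      have h1 := (fderiv ℝ χ x).le_of_opNorm_le (norm_fderiv_le_of_lipschitz ℝ hχ) (φ x)
      rw [Real.norm_eq_abs] at h1
      have h2 := neg_le_of_abs_le h1
      nlinarith [hφ.2.2 x, C.2]
    · rw [indicator_of_notMem hxS, (hext x hxS).fderiv_eq_zero]
      simp
  refine (integral_mono_ae (integrable_finsetSum _ fun i _ => hint i)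
    ((integrable_indicator_iff hS).2 (integrableOn_const hSv)) hbound).trans ?_
  rw [integral_indicator hS, setIntegral_const, smul_eq_mul, mul_comm]

/-- The perimeter of a compact set is at most its outer Minkowski content. -/
lemma perimeter_le_of_volume_shell_le {K : Set Plane} (hK : IsCompact K) (hne : K.Nonempty)
    {m C : ℝ} (hm : 0 ≤ m) (hC : 0 ≤ C)
    (h : ∀ δ > 0, volume ({x | infDist x K < δ} \ K) ≤ ENNReal.ofReal (δ * (m + C * δ))) :
    perimeter K ≤ ENNReal.ofReal m := by
  refine perimeter_le fun φ hφ => ENNReal.ofReal_le_ofReal ?_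
  have hdiv := continuous_divergence hφ.1
  have hdivs : HasCompactSupport (divergence φ) :=
    (hφ.2.1.fderiv (𝕜 := ℝ)).comp_left
      (g := fun L : Plane →L[ℝ] Plane => ∑ i : Fin 2, L (EuclideanSpace.single i 1) i) (by simp)
  let δ : ℕ → ℝ := fun k => 1 / ((k : ℝ) + 1)
  have hδ : ∀ k, 0 < δ k := fun k => Nat.one_div_pos_of_nat
  have hδ0 : Tendsto δ atTop (𝓝 0) := tendsto_one_div_add_atTop_nhds_zero_nat
  -- Tent functions: 1 on `K`, 0 from distance `δ` on, with Lipschitz constant `1 / δ`. This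
  -- constant cancels the factor `δ` in the shell area.
  let χ : ℕ → Plane → ℝ := fun k x => max 0 (1 - infDist x K / δ k)
  have hχ0 : ∀ k x, 0 ≤ χ k x := fun k x => le_max_left _ _
  have hχ1 : ∀ k x, χ k x ≤ 1 := fun k x =>
    max_le zero_le_one (sub_le_self _ (div_nonneg infDist_nonneg (hδ k).le))
  have hχL : ∀ k, LipschitzWith (Real.toNNReal (δ k)⁻¹) (χ k) := by
    intro k
    have h1 : LipschitzWith (Real.toNNReal (δ k)⁻¹) fun x => 1 - infDist x K / δ k := by
      refine LipschitzWith.of_dist_le_mul fun x y => ?_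
      have h2 : |infDist x K - infDist y K| ≤ dist x y := by
        have := (lipschitz_infDist_pt K).dist_le_mul x y
        rwa [NNReal.coe_one, one_mul, Real.dist_eq] at this
      rw [Real.dist_eq, Real.coe_toNNReal _ (inv_nonneg.2 (hδ k).le)]
      have : 1 - infDist x K / δ k - (1 - infDist y K / δ k)
          = -((δ k)⁻¹ * (infDist x K - infDist y K)) := by ring
      rw [this, abs_neg, abs_mul, abs_of_pos (inv_pos.2 (hδ k))]
      exact mul_le_mul_of_nonneg_left h2 (inv_nonneg.2 (hδ k).le)
    exact h1.const_max 0
  have key : ∀ k, ∫ x, χ k x * divergence φ x ≤ m + C * δ k := by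
    intro k
    have hnn : 0 ≤ δ k * (m + C * δ k) := by have := hδ k; positivity
    have hSm : MeasurableSet ({x | infDist x K < δ k} \ K) :=
      ((isOpen_lt (continuous_infDist_pt K) continuous_const).measurableSet).diff hK.measurableSet
    have hv := h (δ k) (hδ k)
    have := integral_lipschitz_mul_divergence_le (hχL k) hSm
      (ne_top_of_le_ne_top ENNReal.ofReal_ne_top hv) (fun x hx => ?_) hφ
    · refine this.trans ?_
      rw [Real.coe_toNNReal _ (inv_nonneg.2 (hδ k).le), Measure.real, inv_mul_le_iff₀ (hδ k)]
      exact ENNReal.toReal_le_of_le_ofReal hnn hv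
    -- Off the shell the cutoff takes its extreme value 1 or 0, hence has a local extremum there,
    -- even at boundary points where it need not be smooth.
    · by_cases hxK : x ∈ K
      · right
        refine Eventually.of_forall fun y => ?_
        have : χ k x = 1 := by simp [χ, infDist_zero_of_mem hxK]
        rw [this]
        exact hχ1 k y
      · left
        have hge : δ k ≤ infDist x K := by
          by_contra! hlt
          exact hx ⟨hlt, hxK⟩
        refine Eventually.of_forall fun y => ?_
        have : χ k x = 0 := max_eq_left (by
          rw [sub_nonpos, one_le_div (hδ k)]
          exact hge)
        rw [this]
        exact hχ0 k y
  have hlim : Tendsto (fun k => ∫ x, χ k x * divergence φ x) atTop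
      (𝓝 (∫ x, K.indicator (divergence φ) x)) := by
    apply tendsto_integral_of_dominated_convergence (fun x => |divergence φ x|)
    · intro k
      exact ((hχL k).continuous.mul hdiv).aestronglyMeasurable
    · exact (hdiv.integrable_of_hasCompactSupport hdivs).abs
    · intro k
      refine Eventually.of_forall fun x => ?_
      rw [Real.norm_eq_abs, abs_mul, abs_of_nonneg (hχ0 k x)]
      exact mul_le_of_le_one_left (abs_nonneg _) (hχ1 k x)
    · refine Eventually.of_forall fun x => ?_
      by_cases hx : x ∈ K
      · have : ∀ k, χ k x = 1 := fun k => by simp [χ, infDist_zero_of_mem hx]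
        simp [this, indicator_of_mem hx]
      · rw [indicator_of_notMem hx]
        apply tendsto_const_nhds.congr'
        have hpos : 0 < infDist x K := (hK.isClosed.notMem_iff_infDist_pos hne).1 hx
        filter_upwards [hδ0.eventually (gt_mem_nhds hpos)] with k hk
        have : χ k x = 0 := max_eq_left (by
          rw [sub_nonpos, one_le_div (hδ k)]
          exact hk.le)
        simp [this]
  rw [integral_indicator hK.measurableSet] at hlim
  have hlim2 : Tendsto (fun k => m + C * δ k) atTop (𝓝 m) := by
    simpa using (hδ0.const_mul C).const_add m
  exact le_of_tendsto_of_tendsto' hlim hlim2 key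

/-! ### Discs -/

lemma volume_closedBall_eq (x : Plane) {r : ℝ} (hr : 0 ≤ r) :
    volume (closedBall x r) = ENNReal.ofReal (Real.pi * r ^ 2) := by
  rw [EuclideanSpace.volume_closedBall_fin_two, ← ENNReal.ofReal_pow hr,
    ← ENNReal.ofReal_mul (by positivity), mul_comm]

/-- Above: the annulus of width `δ` has area `δ (2πr + πδ)`. Below: the radial fields `y / R'` with
`R'` decreasing to `r`, each of norm at most one on the disc of radius `R'` and of divergence `2 /
R'`. -/
lemma perimeter_closedBall {r : ℝ} (hr : 0 < r) :
    perimeter (closedBall (0 : Plane) r) = ENNReal.ofReal (2 * Real.pi * r) := by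
  apply le_antisymm
  · refine perimeter_le_of_volume_shell_le (isCompact_closedBall 0 r) ⟨0, by simp [hr.le]⟩
      (C := Real.pi) (by positivity) (by positivity) fun δ hδ => ?_
    have hsub : {x | infDist x (closedBall (0 : Plane) r) < δ} \ closedBall 0 r
        ⊆ closedBall 0 (r + δ) \ closedBall 0 r := by
      refine sdiff_subset_sdiff_left fun x hx => ?_
      obtain ⟨y, hy, hlt⟩ := (infDist_lt_iff ⟨0, by simp [hr.le]⟩).1 hx
      rw [mem_closedBall] at hy ⊢
      linarith [dist_triangle x y 0]
    refine (measure_mono hsub).trans ?_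
    rw [measure_sdiff (closedBall_subset_closedBall (by linarith))
      isClosed_closedBall.measurableSet.nullMeasurableSet
      (isCompact_closedBall _ _).measure_lt_top.ne,
      volume_closedBall_eq _ (by positivity), volume_closedBall_eq _ hr.le,
      ← ENNReal.ofReal_sub _ (by positivity)]
    apply ENNReal.ofReal_le_ofReal
    nlinarith
  · have h : ∀ R' > r, ENNReal.ofReal (2 * R'⁻¹ * (Real.pi * r ^ 2))
        ≤ perimeter (closedBall (0 : Plane) r) := by
      intro R' hR'
      have hpos : 0 < R' := hr.trans hR'
      have := le_perimeter_of_subset_closedBall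
        (isClosed_closedBall (x := (0 : Plane)) (ε := r)).measurableSet hr.le hR' Subset.rfl
        (φ := fun y => R'⁻¹ • y) (by fun_prop) (fun x hx => ?_)
      · simp only [divergence_const_smul_id, setIntegral_const, smul_eq_mul, Measure.real,
          volume_closedBall_eq _ hr.le] at this
        rwa [ENNReal.toReal_ofReal (by positivity), mul_comm] at this
      · rw [norm_smul, Real.norm_eq_abs, abs_of_pos (inv_pos.2 hpos), inv_mul_le_iff₀ hpos, mul_one]
        exact (mem_ball_zero_iff.1 hx).le
    have hlim : Tendsto (fun R' : ℝ => ENNReal.ofReal (2 * R'⁻¹ * (Real.pi * r ^ 2))) (𝓝[>] r)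
        (𝓝 (ENNReal.ofReal (2 * Real.pi * r))) := by
      have : ContinuousAt (fun R' : ℝ => 2 * R'⁻¹ * (Real.pi * r ^ 2)) r := by
        have : r ≠ 0 := hr.ne'
        fun_prop (disch := assumption)
      have h2 := this.tendsto
      have e : 2 * r⁻¹ * (Real.pi * r ^ 2) = 2 * Real.pi * r := by
        field_simp
      rw [e] at h2
      exact ((ENNReal.continuous_ofReal.tendsto _).comp h2).mono_left nhdsWithin_le_nhds
    exact le_of_tendsto hlim (eventually_nhdsWithin_of_forall h)

/-! ### Rectangles -/

/-- The rectangle with sides parallel to an orthonormal basis. -/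
def rect (b : OrthonormalBasis (Fin 2) ℝ Plane) (l u : Fin 2 → ℝ) : Set Plane :=
  {x | ∀ i, inner ℝ (b i) x ∈ Icc (l i) (u i)}

lemma rect_eq_preimage (b : OrthonormalBasis (Fin 2) ℝ Plane) (l u : Fin 2 → ℝ) :
    rect b l u = b.repr ⁻¹' ((WithLp.ofLp : Plane → Fin 2 → ℝ) ⁻¹' Icc l u) := by
  ext x
  simp only [rect, mem_ofPred_eq, mem_preimage, mem_Icc, Pi.le_def, b.repr_apply_apply]
  exact ⟨fun h => ⟨fun i => (h i).1, fun i => (h i).2⟩, fun h i => ⟨h.1 i, h.2 i⟩⟩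

lemma volume_rect (b : OrthonormalBasis (Fin 2) ℝ Plane) (l u : Fin 2 → ℝ) :
    volume (rect b l u) = ENNReal.ofReal (u 0 - l 0) * ENNReal.ofReal (u 1 - l 1) := by
  have hm : MeasurableSet ((WithLp.ofLp : Plane → Fin 2 → ℝ) ⁻¹' Icc l u) :=
    (PiLp.volume_preserving_ofLp (Fin 2)).measurable measurableSet_Icc
  rw [rect_eq_preimage, b.measurePreserving_repr.measure_preimage hm.nullMeasurableSet,
    (PiLp.volume_preserving_ofLp (Fin 2)).measure_preimage measurableSet_Icc.nullMeasurableSet,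
    Real.volume_Icc_pi, Fin.prod_univ_two]

lemma isClosed_rect (b : OrthonormalBasis (Fin 2) ℝ Plane) (l u : Fin 2 → ℝ) :
    IsClosed (rect b l u) := by
  have : rect b l u = ⋂ i, (fun x => inner ℝ (b i) x) ⁻¹' Icc (l i) (u i) := by
    ext x; simp [rect]
  rw [this]
  exact isClosed_iInter fun i => isClosed_Icc.preimage (by fun_prop)

lemma convex_rect (b : OrthonormalBasis (Fin 2) ℝ Plane) (l u : Fin 2 → ℝ) :
    Convex ℝ (rect b l u) := by
  have : rect b l u = ⋂ i, (innerSL ℝ (b i)) ⁻¹' Icc (l i) (u i) := by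
    ext x; simp [rect]
  rw [this]
  exact convex_iInter fun i => (convex_Icc (l i) (u i)).linear_preimage
    (innerSL ℝ (b i)).toLinearMap

lemma sq_norm_eq_inner_basis (b : OrthonormalBasis (Fin 2) ℝ Plane) (x : Plane) :
    ‖x‖ ^ 2 = inner ℝ (b 0) x ^ 2 + inner ℝ (b 1) x ^ 2 := by
  have := b.sum_sq_norm_inner_right x
  simpa [Fin.sum_univ_two] using this.symm

lemma isCompact_rect (b : OrthonormalBasis (Fin 2) ℝ Plane) (l u : Fin 2 → ℝ) :
    IsCompact (rect b l u) := by
  rw [rect_eq_preimage, ← preimage_comp]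
  exact (b.repr.toHomeomorph.trans
    (PiLp.homeomorph 2 (fun _ : Fin 2 => ℝ))).isCompact_preimage.2 isCompact_Icc

lemma abs_inner_basis_le (b : OrthonormalBasis (Fin 2) ℝ Plane) (i : Fin 2) (x : Plane) :
    |inner ℝ (b i) x| ≤ ‖x‖ := by
  simpa using abs_real_inner_le_norm (b i) x

/-- The shell lies in the rectangle enlarged by `δ` on each side, whose extra area is `δ` times the
perimeter plus `4 δ ^ 2`. -/
lemma perimeter_rect_le (b : OrthonormalBasis (Fin 2) ℝ Plane) {l u : Fin 2 → ℝ}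
    (h : ∀ i, l i ≤ u i) (hne : (rect b l u).Nonempty) :
    perimeter (rect b l u) ≤ ENNReal.ofReal (2 * ((u 0 - l 0) + (u 1 - l 1))) := by
  have h0 := sub_nonneg.2 (h 0)
  have h1 := sub_nonneg.2 (h 1)
  refine perimeter_le_of_volume_shell_le (isCompact_rect b l u) hne
      (C := 4) (by positivity) (by positivity) fun δ hδ => ?_
  have hsub : {x | infDist x (rect b l u) < δ} ⊆ rect b (fun i => l i - δ) (fun i => u i + δ) := by
    intro x hx i
    obtain ⟨y, hy, hlt⟩ := (infDist_lt_iff hne).1 hx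
    have h2 := abs_inner_basis_le b i (x - y)
    rw [← dist_eq_norm, inner_sub_right] at h2
    have h3 := abs_le.1 (h2.trans hlt.le)
    have h4 := hy i
    exact ⟨by linarith [h4.1], by linarith [h4.2]⟩
  have hsub' : rect b l u ⊆ rect b (fun i => l i - δ) (fun i => u i + δ) := fun x hx i =>
    ⟨by linarith [(hx i).1], by linarith [(hx i).2]⟩
  refine (measure_mono (sdiff_subset_sdiff_left hsub)).trans ?_
  rw [measure_sdiff hsub' (isClosed_rect b l u).measurableSet.nullMeasurableSet
    (isCompact_rect b l u).measure_lt_top.ne, volume_rect, volume_rect,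
    ← ENNReal.ofReal_mul (by linarith), ← ENNReal.ofReal_mul h0,
    ← ENNReal.ofReal_sub _ (by positivity)]
  apply ENNReal.ofReal_le_ofReal
  nlinarith

/-- Test with the field `sin (k (⟨b 1, x⟩ - m)) b 1`. On the rectangle its divergence is `k cos`, at
least `k / 2` since the argument is at most `1 / 2` in absolute value. The constant is crude; only
the order of magnitude matters. -/
lemma le_perimeter_rect (b : OrthonormalBasis (Fin 2) ℝ Plane) {l u : Fin 2 → ℝ} {k m : ℝ}
    (hk : 0 < k) (h : ∀ s ∈ Icc (l 1) (u 1), |k * (s - m)| ≤ 1 / 2) :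
    ENNReal.ofReal (k / 2) * volume (rect b l u) ≤ perimeter (rect b l u) := by
  have hder : ∀ x : Plane, HasFDerivAt (fun x : Plane => Real.sin (k * (inner ℝ (b 1) x - m)))
      (Real.cos (k * (inner ℝ (b 1) x - m)) • k • innerSL ℝ (b 1)) x := by
    intro x
    have h1 : HasFDerivAt (fun x : Plane => k * (inner ℝ (b 1) x - m)) (k • innerSL ℝ (b 1)) x := by
      have := ((innerSL ℝ (b 1)).hasFDerivAt (x := x)).sub_const m
      simpa using this.const_mul k
    exact (Real.hasDerivAt_sin _).comp_hasFDerivAt x h1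
  have hc : ContDiff ℝ 1 fun x : Plane => Real.sin (k * (inner ℝ (b 1) x - m)) :=
    Real.contDiff_sin.comp
      (contDiff_const.mul ((contDiff_const.inner ℝ contDiff_id).sub contDiff_const))
  have hφ : ContDiff ℝ 1 fun x : Plane => Real.sin (k * (inner ℝ (b 1) x - m)) • b 1 :=
    hc.smul contDiff_const
  have hle := le_perimeter_of_isBounded (isClosed_rect b l u).measurableSet
    (isCompact_rect b l u).isBounded hφ (fun x => by
      rw [norm_smul, b.orthonormal.1 1, mul_one]
      exact Real.abs_sin_le_one _)
  refine le_trans ?_ hle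
  have hfin : volume (rect b l u) ≠ ⊤ := (isCompact_rect b l u).measure_lt_top.ne
  rw [← ENNReal.ofReal_toReal hfin, ← ENNReal.ofReal_mul (by positivity)]
  apply ENNReal.ofReal_le_ofReal
  have e : k / 2 * (volume (rect b l u)).toReal = ∫ x in rect b l u, k / 2 := by
    rw [setIntegral_const, smul_eq_mul, mul_comm]; rfl
  rw [e]
  refine setIntegral_mono_on (integrableOn_const hfin)
    (integrableOn_of_continuous (isCompact_rect b l u).isBounded (continuous_divergence hφ))
    (isClosed_rect b l u).measurableSet fun x hx => ?_
  rw [divergence_smul_const (hder x).differentiableAt, (hder x).fderiv]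
  have h2 := Real.one_sub_sq_div_two_le_cos (x := k * (inner ℝ (b 1) x - m))
  have h3 := h _ (hx 1)
  have h4 : (k * (inner ℝ (b 1) x - m)) ^ 2 ≤ (1 / 2) ^ 2 := sq_le_sq' (abs_le.1 h3).1 (abs_le.1 h3).2
  simp only [smul_apply, innerSL_apply_apply, real_inner_self_eq_norm_sq,
    b.orthonormal.1 1, smul_eq_mul]
  nlinarith

lemma exists_orthonormalBasis {e : Plane} (he : ‖e‖ = 1) :
    ∃ b : OrthonormalBasis (Fin 2) ℝ Plane, b 0 = e := by
  obtain ⟨b, hb⟩ := Orthonormal.exists_orthonormalBasis_extension_of_card_eq (𝕜 := ℝ) (E := Plane)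
    (ι := Fin 2) (by simp) (v := fun _ => e) (s := {0}) (by
      constructor
      · intro i; simpa using he
      · intro i j hij
        exact absurd (Subsingleton.elim i j) hij)
  exact ⟨b, hb 0 rfl⟩

lemma eq_add_inner_basis (b : OrthonormalBasis (Fin 2) ℝ Plane) (x : Plane) :
    x = inner ℝ (b 0) x • b 0 + inner ℝ (b 1) x • b 1 := by
  have := b.sum_repr x
  simpa [Fin.sum_univ_two, b.repr_apply_apply] using this.symm

/-- A convex set containing a disc and a point contains a rectangle between them. -/
lemma exists_rect_subset {K : Set Plane} (hc : Convex ℝ K) {x p : Plane} {ρ : ℝ} (hρ : 0 ≤ ρ)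
    (hx : closedBall x ρ ⊆ K) (hp : p ∈ K) (hD : 0 < dist p x) :
    ∃ b : OrthonormalBasis (Fin 2) ℝ Plane, rect b
      ![inner ℝ (b 0) x, inner ℝ (b 1) x - ρ / 2]
      ![inner ℝ (b 0) x + dist p x / 2, inner ℝ (b 1) x + ρ / 2] ⊆ K := by
  set D := dist p x with hDdef
  have hDn : ‖p - x‖ = D := by rw [hDdef, dist_eq_norm]
  obtain ⟨b, hb⟩ := exists_orthonormalBasis (e := D⁻¹ • (p - x))
    (by rw [norm_smul, hDn, Real.norm_eq_abs, abs_of_pos (inv_pos.2 hD), inv_mul_cancel₀ hD.ne'])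
  have hpx : p = x + D • b 0 := by rw [hb, smul_inv_smul₀ hD.ne']; abel
  refine ⟨b, fun y hy => ?_⟩
  have hy0 := hy 0
  have hy1 := hy 1
  simp only [Matrix.cons_val_zero, Matrix.cons_val_one, mem_Icc] at hy0 hy1
  set s := inner ℝ (b 0) (y - x) with hs
  set v := inner ℝ (b 1) (y - x) with hv
  rw [inner_sub_right] at hs hv
  have hyx : y = x + (s • b 0 + v • b 1) := by
    have := eq_add_inner_basis b (y - x)
    rw [hs, hv, ← inner_sub_right, ← inner_sub_right, ← this]; abel
  have hl : 1 / 2 ≤ 1 - s / D := by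
    have : s / D ≤ 1 / 2 := by rw [div_le_iff₀ hD]; linarith
    linarith
  have hs0 : 0 ≤ s / D := div_nonneg (by linarith) hD.le
  -- The line from `p` through `y` meets the line through `x` orthogonal to `p - x` at this point;
  -- it is in the disc since `1 - s / D ≥ 1 / 2` and `|v| ≤ ρ / 2`.
  have hq : x + (v / (1 - s / D)) • b 1 ∈ K := by
    apply hx
    rw [mem_closedBall, dist_eq_norm, add_sub_cancel_left, norm_smul, b.orthonormal.1 1, mul_one,
      Real.norm_eq_abs, abs_div, abs_of_pos (by linarith : 0 < 1 - s / D),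
      div_le_iff₀ (by linarith)]
    have : |v| ≤ ρ / 2 := abs_le.2 ⟨by linarith, by linarith⟩
    nlinarith
  have := hc hq hp (by linarith : 0 ≤ 1 - s / D) hs0 (by ring)
  convert this using 1
  rw [hyx, hpx]
  simp only [smul_add, smul_smul]
  rw [mul_div_cancel₀ _ (by linarith : (1 - s / D) ≠ 0), div_mul_cancel₀ _ hD.ne']
  module

lemma le_volume_of_closedBall_subset {K : Set Plane} (hK : K ∈ convexBodies) {x p : Plane} {ρ : ℝ}
    (hρ : 0 < ρ) (hx : closedBall x ρ ⊆ K) (hp : p ∈ K) (hD : 0 < dist p x) :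
    ENNReal.ofReal (dist p x * ρ / 2) ≤ volume K := by
  obtain ⟨b, hb⟩ := exists_rect_subset hK.2.1 hρ.le hx hp hD
  refine le_trans ?_ (measure_mono hb)
  rw [volume_rect, ← ENNReal.ofReal_mul (by simp; positivity)]
  apply ENNReal.ofReal_le_ofReal
  simp
  nlinarith

lemma le_perimeter_of_closedBall_subset {K : Set Plane} (hK : K ∈ convexBodies) {x p : Plane}
    {ρ : ℝ} (hρ : 0 < ρ) (hx : closedBall x ρ ⊆ K) (hp : p ∈ K) (hD : 0 < dist p x) :
    ENNReal.ofReal (dist p x / 4) ≤ perimeter K := by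
  obtain ⟨b, hb⟩ := exists_rect_subset hK.2.1 hρ.le hx hp hD
  have hmem : x ∈ rect b ![inner ℝ (b 0) x, inner ℝ (b 1) x - ρ / 2]
      ![inner ℝ (b 0) x + dist p x / 2, inner ℝ (b 1) x + ρ / 2] := by
    intro i
    fin_cases i
    · simp; positivity
    · simp; positivity
  refine le_trans ?_ (perimeter_mono_of_convex (isClosed_rect b _ _) (convex_rect b _ _) ⟨x, hmem⟩
    hK.1.measurableSet hK.1.isBounded hb)
  -- The rectangle has sides `D / 2` and `ρ`, where `D = dist p x`; with `k = 1 / ρ` the lower bound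
  -- is `(1 / (2ρ)) (Dρ / 2) = D / 4`, independent of `ρ`.
  refine le_trans ?_ (le_perimeter_rect b (k := ρ⁻¹) (m := inner ℝ (b 1) x) (inv_pos.2 hρ) ?_)
  · rw [volume_rect, ← ENNReal.ofReal_mul (by simp; positivity),
      ← ENNReal.ofReal_mul (by positivity)]
    apply ENNReal.ofReal_le_ofReal
    simp
    field_simp
    norm_num
  · intro s hs
    simp only [Matrix.cons_val_one, Matrix.cons_val_zero, mem_Icc] at hs
    rw [abs_mul, abs_of_pos (inv_pos.2 hρ), inv_mul_le_iff₀ hρ, abs_le]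
    constructor <;> linarith

/-! ### Compactness of classes of convex bodies -/

/-- Write `x / t` as the convex combination of `y` and `(x - y) / (t - 1)` with weights `1 / t` and
`(t - 1) / t`. The second point is in the disc of radius `ρ`. -/
lemma subset_image_dilate_of_near {A L : Set Plane} (hL : Convex ℝ L) {ρ t : ℝ}
    (ht : 1 < t) (hb : closedBall 0 ρ ⊆ L) (h : ∀ x ∈ A, ∃ y ∈ L, dist x y ≤ (t - 1) * ρ) :
    A ⊆ dilate 0 t '' L := by
  intro x hx
  obtain ⟨y, hy, hd⟩ := h x hx
  have ht0 : 0 < t := by linarith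
  have ht1 : 0 < t - 1 := by linarith
  have hv : (t - 1)⁻¹ • (x - y) ∈ L := by
    apply hb
    rw [mem_closedBall_zero_iff, norm_smul, Real.norm_eq_abs, abs_of_pos (inv_pos.2 ht1),
      ← dist_eq_norm, inv_mul_le_iff₀ ht1]
    exact hd
  refine ⟨_, hL hy hv (inv_nonneg.2 ht0.le) (div_nonneg ht1.le ht0.le) (by field_simp; ring), ?_⟩
  simp only [dilate, zero_add, smul_add, smul_smul]
  rw [mul_inv_cancel₀ ht0.ne', show t * ((t - 1) / t * (t - 1)⁻¹) = 1 by field_simp]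
  module

/-- Blaschke selection. After translation all bodies contain the disc of radius `ρ` at the origin
and lie in a fixed disc, so a subsequence converges in the Hausdorff metric. The common disc, which
`K` inherits, upgrades convergence to two-sided inclusion up to a factor `t`. -/
lemma exists_limit_body {ρ M : ℝ} (hρ : 0 < ρ) {Ω : ℕ → Set Plane}
    (hΩ : ∀ n, Ω n ∈ convexBodies) (hin : ∀ n, ∃ x, closedBall x ρ ⊆ Ω n)
    (hM : ∀ n, diam (Ω n) ≤ M) :
    ∃ K ∈ convexBodies, ∃ φ : ℕ → ℕ, StrictMono φ ∧ ∀ t > 1, ∀ᶠ n in atTop,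
      (∃ c, K ⊆ dilate c t '' Ω (φ n)) ∧ ∃ c, Ω (φ n) ⊆ dilate c t '' K := by
  choose x hx using hin
  have hcomp : ∀ n, IsCompact (dilate (-x n) 1 '' Ω n) := fun n =>
    (hΩ n).1.image (continuous_dilate _ _)
  have hball : ∀ n, closedBall 0 ρ ⊆ dilate (-x n) 1 '' Ω n := by
    intro n y hy
    refine ⟨x n + y, hx n ?_, by simp [dilate]⟩
    rw [mem_closedBall, dist_eq_norm, add_sub_cancel_left]
    exact mem_closedBall_zero_iff.1 hy
  let L : ℕ → TopologicalSpace.NonemptyCompacts Plane := fun n =>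
    ⟨⟨dilate (-x n) 1 '' Ω n, hcomp n⟩, ((hΩ n).2.2.mono interior_subset).image _⟩
  have hLcoe : ∀ n, (L n : Set Plane) = dilate (-x n) 1 '' Ω n := fun n => rfl
  have hLconv : ∀ n, Convex ℝ (L n : Set Plane) := by
    intro n
    rw [hLcoe]
    have e : dilate (-x n) 1 = fun y => -x n + y := by
      funext y
      simp [dilate]
    rw [e]
    exact (hΩ n).2.1.translate (-x n)
  have hsub : ∀ n, (L n : Set Plane) ⊆ closedBall 0 M := by
    rintro n _ ⟨y, hy, rfl⟩
    rw [mem_closedBall_zero_iff]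
    have := dist_le_diam_of_mem (hΩ n).1.isBounded hy (hx n (mem_closedBall_self hρ.le))
    rw [dist_eq_norm] at this
    have e : dilate (-x n) 1 y = y - x n := by simp only [dilate, one_smul]; abel
    rw [e]
    exact this.trans (hM n)
  obtain ⟨K, -, φ, hφ, hlim⟩ :=
    (TopologicalSpace.NonemptyCompacts.isCompact_subsets_of_isCompact
      (isCompact_closedBall (0 : Plane) M)).tendsto_subseq hsub
  have hKb : Bornology.IsBounded (K : Set Plane) := K.isCompact.isBounded
  have hfin : ∀ n, hausdorffEDist (L n : Set Plane) K ≠ ⊤ := fun n =>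
    hausdorffEDist_ne_top_of_nonempty_of_bounded (L n).nonempty K.nonempty
      (L n).isCompact.isBounded hKb
  have hnear : ∀ δ > 0, ∀ᶠ n in atTop, hausdorffDist (L (φ n) : Set Plane) K < δ := by
    intro δ hδ
    filter_upwards [Metric.tendsto_nhds.1 hlim δ hδ] with n hn
    simpa [NonemptyCompacts.dist_eq] using hn
  -- Points approximable infinitely often by the bodies belong to the closed limit; both the disc
  -- and convexity pass to `K` through this.
  have hmemK : ∀ y : Plane, (∀ δ > 0, ∃ᶠ n in atTop, ∃ z ∈ (L (φ n) : Set Plane), dist y z ≤ δ) →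
      y ∈ (K : Set Plane) := by
    intro y hy
    rw [← K.isCompact.isClosed.closure_eq, Metric.mem_closure_iff]
    intro ε hε
    obtain ⟨n, ⟨z, hz, hyz⟩, hn⟩ := ((hy (ε / 2) (by positivity)).and_eventually
      (hnear (ε / 2) (by positivity))).exists
    obtain ⟨w, hw, hzw⟩ := exists_dist_lt_of_hausdorffDist_lt hz hn (hfin _)
    exact ⟨w, hw, by linarith [dist_triangle y z w]⟩
  have hKball : closedBall 0 ρ ⊆ (K : Set Plane) := fun y hy => hmemK y fun δ hδ =>
    Frequently.of_forall fun n => ⟨y, hball (φ n) hy, by simpa using hδ.le⟩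
  have hKconv : Convex ℝ (K : Set Plane) := by
    intro y hy z hz a b ha hb hab
    refine hmemK _ fun δ hδ => ((hnear δ hδ).mono fun n hn => ?_).frequently
    obtain ⟨y', hy', hyy⟩ := exists_dist_lt_of_hausdorffDist_lt' hy hn (hfin _)
    obtain ⟨z', hz', hzz⟩ := exists_dist_lt_of_hausdorffDist_lt' hz hn (hfin _)
    refine ⟨a • y' + b • z', hLconv _ hy' hz' ha hb hab, ?_⟩
    rw [dist_comm] at hyy hzz
    calc dist (a • y + b • z) (a • y' + b • z')
        ≤ dist (a • y) (a • y') + dist (b • z) (b • z') := dist_add_add_le _ _ _ _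
      _ = a * dist y y' + b * dist z z' := by
        rw [dist_smul₀, dist_smul₀, Real.norm_eq_abs, Real.norm_eq_abs, abs_of_nonneg ha,
          abs_of_nonneg hb]
      _ ≤ a * δ + b * δ := by gcongr
      _ = δ := by rw [← add_mul, hab, one_mul]
  refine ⟨K, mem_convexBodies_of_closedBall_subset K.isCompact hKconv hρ hKball, φ, hφ,
    fun t ht => ?_⟩
  filter_upwards [hnear ((t - 1) * ρ) (mul_pos (by linarith) hρ)] with n hn
  constructor
  · refine ⟨t • -x (φ n), ?_⟩
    have := subset_image_dilate_of_near (A := (K : Set Plane)) (hLconv (φ n)) ht (hball (φ n))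
      fun y hy => by
        obtain ⟨z, hz, hlt⟩ := exists_dist_lt_of_hausdorffDist_lt' hy hn (hfin _)
        exact ⟨z, hz, by rw [dist_comm]; exact hlt.le⟩
    intro y hy
    obtain ⟨_, ⟨z, hz, rfl⟩, e⟩ := this hy
    exact ⟨z, hz, by rw [← e]; simp [dilate, smul_add]⟩
  · refine ⟨x (φ n), ?_⟩
    have := subset_image_dilate_of_near (A := (L (φ n) : Set Plane)) hKconv ht hKball
      fun y hy => by
        obtain ⟨z, hz, hlt⟩ := exists_dist_lt_of_hausdorffDist_lt hy hn (hfin _)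
        exact ⟨z, hz, hlt.le⟩
    intro y hy
    obtain ⟨z, hz, e⟩ := this (⟨y, hy, rfl⟩ : dilate (-x (φ n)) 1 y ∈ (L (φ n) : Set Plane))
    refine ⟨z, hz, ?_⟩
    simp only [dilate, zero_add, one_smul] at e ⊢
    rw [e]; abel

lemma le_of_forall_le_ofReal_pow_mul {x y : ENNReal} {k : ℕ}
    (h : ∀ t : ℝ, 1 < t → x ≤ ENNReal.ofReal t ^ k * y) : x ≤ y := by
  have h1 : Tendsto (fun t : ℝ => ENNReal.ofReal t ^ k * y) (𝓝[>] 1)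
      (𝓝 (ENNReal.ofReal 1 ^ k * y)) := by
    refine ENNReal.Tendsto.mul_const ?_ (Or.inl (by simp))
    exact ((ENNReal.continuous_pow k).tendsto _).comp
      ((ENNReal.continuous_ofReal.tendsto _).mono_left nhdsWithin_le_nhds)
  rw [ENNReal.ofReal_one, one_pow, one_mul] at h1
  exact ge_of_tendsto h1 (eventually_nhdsWithin_of_forall h)

/-- Each inclusion gives one inequality up to `t ^ k`, and `t` tends to 1. This takes the place of
continuity in the Hausdorff metric. -/
lemma HomogeneousMonotone.eq_of_sandwich {k : ℕ} {F : Set Plane → ENNReal}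
    (hF : HomogeneousMonotone k F) {K : Set Plane} (hK : K ∈ convexBodies) {a : ENNReal}
    (h : ∀ t : ℝ, 1 < t → ∃ Ω ∈ convexBodies, F Ω = a ∧
      (∃ c, K ⊆ dilate c t '' Ω) ∧ ∃ c, Ω ⊆ dilate c t '' K) : F K = a := by
  apply le_antisymm
  · refine le_of_forall_le_ofReal_pow_mul (k := k) fun t ht => ?_
    obtain ⟨Ω, hΩ, rfl, ⟨c, hc⟩, -⟩ := h t ht
    exact hF K hK Ω hΩ c t (by linarith) hc
  · refine le_of_forall_le_ofReal_pow_mul (k := k) fun t ht => ?_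
    obtain ⟨Ω, hΩ, rfl, -, ⟨c, hc⟩⟩ := h t ht
    exact hF Ω hΩ K hK c t (by linarith) hc

/-- A nonempty class of convex bodies cut out by two homogeneous monotone functionals, whose
members have bounded diameter and contain discs of a fixed radius. -/
theorem cheegerAttainsMinAndMax_of_bounds {k l : ℕ} {F G : Set Plane → ENNReal}
    (hF : HomogeneousMonotone k F) (hG : HomogeneousMonotone l G) {a b : ENNReal} {ρ M : ℝ}
    (hρ : 0 < ρ)
    (hbd : ∀ Ω ∈ convexBodies, F Ω = a → G Ω = b → (∃ x, closedBall x ρ ⊆ Ω) ∧ diam Ω ≤ M)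
    (hne : ∃ Ω ∈ convexBodies, F Ω = a ∧ G Ω = b) :
    CheegerAttainsMinAndMax {Ω ∈ convexBodies | F Ω = a ∧ G Ω = b} := by
  set C : Set (Set Plane) := {Ω ∈ convexBodies | F Ω = a ∧ G Ω = b} with hCdef
  have hneC : (cheeger '' C).Nonempty := by
    obtain ⟨Ω, h⟩ := hne
    exact ⟨_, Ω, h, rfl⟩
  have hlimit : ∀ Ω : ℕ → Set Plane, (∀ n, Ω n ∈ C) → ∃ K ∈ C, ∃ φ : ℕ → ℕ, StrictMono φ ∧
      ∀ t > 1, ∀ᶠ n in atTop,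
        (∃ c, K ⊆ dilate c t '' Ω (φ n)) ∧ ∃ c, Ω (φ n) ⊆ dilate c t '' K := by
    intro Ω hΩ
    obtain ⟨K, hK, φ, hφ, hs⟩ := exists_limit_body hρ (fun n => (hΩ n).1)
      (fun n => (hbd _ (hΩ n).1 (hΩ n).2.1 (hΩ n).2.2).1)
      (fun n => (hbd _ (hΩ n).1 (hΩ n).2.1 (hΩ n).2.2).2)
    refine ⟨K, ⟨hK, hF.eq_of_sandwich hK fun t ht => ?_, hG.eq_of_sandwich hK fun t ht => ?_⟩,
      φ, hφ, hs⟩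
    · obtain ⟨n, hn⟩ := (hs t ht).exists
      exact ⟨Ω (φ n), (hΩ _).1, (hΩ _).2.1, hn⟩
    · obtain ⟨n, hn⟩ := (hs t ht).exists
      exact ⟨Ω (φ n), (hΩ _).1, (hΩ _).2.2, hn⟩
  constructor
  -- Minimum: the inclusion of the sequence in `t` times `K` bounds `cheeger K` above by `t` times
  -- the infimum.
  · obtain ⟨v, -, hvlim, hv⟩ := exists_seq_tendsto_sInf hneC (OrderBot.bddBelow _)
    choose Ω hΩ hΩv using hv
    obtain ⟨K, hK, φ, hφ, hs⟩ := hlimit Ω hΩ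
    refine ⟨K, hK, ?_⟩
    have hle : cheeger K ≤ sInf (cheeger '' C) := by
      refine le_of_forall_le_ofReal_pow_mul (k := 1) fun t ht => ?_
      have h1 : Tendsto (fun n => ENNReal.ofReal t ^ 1 * v (φ n)) atTop
          (𝓝 (ENNReal.ofReal t ^ 1 * sInf (cheeger '' C))) :=
        ENNReal.Tendsto.const_mul (hvlim.comp hφ.tendsto_atTop) (Or.inr (by simp))
      refine ge_of_tendsto h1 ?_
      filter_upwards [hs t ht] with n hn
      obtain ⟨-, c, hc⟩ := hn
      rw [pow_one, ← hΩv]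
      exact cheeger_le_of_subset_image_dilate (by linarith) hc
    exact isMinOn_iff.2 fun Ω' hΩ' => hle.trans (sInf_le ⟨Ω', hΩ', rfl⟩)
  -- Maximum: the opposite inclusion bounds the supremum by `t * cheeger K`.
  · obtain ⟨v, -, hvlim, hv⟩ := exists_seq_tendsto_sSup hneC (OrderTop.bddAbove _)
    choose Ω hΩ hΩv using hv
    obtain ⟨K, hK, φ, hφ, hs⟩ := hlimit Ω hΩ
    refine ⟨K, hK, ?_⟩
    have hle : sSup (cheeger '' C) ≤ cheeger K := by
      refine le_of_forall_le_ofReal_pow_mul (k := 1) fun t ht => ?_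
      refine le_of_tendsto (hvlim.comp hφ.tendsto_atTop) ?_
      filter_upwards [hs t ht] with n hn
      obtain ⟨⟨c, hc⟩, -⟩ := hn
      rw [pow_one, Function.comp_apply, ← hΩv]
      exact cheeger_le_of_subset_image_dilate (by linarith) hc
    exact isMaxOn_iff.2 fun Ω' hΩ' => (le_sSup (mem_image_of_mem cheeger hΩ')).trans hle

/-! ### Discs inside triangles -/

/-- The determinant of two vectors of the plane. -/
def cross (v w : Plane) : ℝ := v 0 * w 1 - v 1 * w 0

lemma norm_sq_eq_coord (v : Plane) : ‖v‖ ^ 2 = v 0 ^ 2 + v 1 ^ 2 := by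
  simp [EuclideanSpace.norm_sq_eq, Fin.sum_univ_two]

lemma inner_eq_coord (v w : Plane) : inner ℝ v w = v 0 * w 0 + v 1 * w 1 := by
  simp [PiLp.inner_apply, Fin.sum_univ_two, mul_comm]

lemma cross_sq_add_inner_sq (v w : Plane) :
    cross v w ^ 2 + inner ℝ v w ^ 2 = ‖v‖ ^ 2 * ‖w‖ ^ 2 := by
  rw [norm_sq_eq_coord, norm_sq_eq_coord, inner_eq_coord, cross]
  ring

lemma abs_cross_le (v w : Plane) : |cross v w| ≤ ‖v‖ * ‖w‖ := by
  apply abs_le_of_sq_le_sq _ (by positivity)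
  nlinarith [cross_sq_add_inner_sq v w, sq_nonneg (inner ℝ v w)]

lemma abs_cross_basis (b : OrthonormalBasis (Fin 2) ℝ Plane) (w : Plane) :
    |cross (b 0) w| = |inner ℝ (b 1) w| := by
  rw [← sq_eq_sq_iff_abs_eq_abs]
  have h1 := cross_sq_add_inner_sq (b 0) w
  rw [b.orthonormal.1 0, sq_norm_eq_inner_basis b w] at h1
  linarith

lemma cross_smul_left (t : ℝ) (v w : Plane) : cross (t • v) w = t * cross v w := by
  simp [cross]; ring

lemma convex_combination_mem {K : Set Plane} (hc : Convex ℝ K) {a b c : Plane} (ha : a ∈ K)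
    (hb : b ∈ K) (hcK : c ∈ K) {α β γ : ℝ} (hα : 0 ≤ α) (hβ : 0 ≤ β) (hγ : 0 ≤ γ)
    (h : α + β + γ = 1) : α • a + β • b + γ • c ∈ K := by
  have := hc.sum_mem (t := Finset.univ) (w := ![α, β, γ]) (z := ![a, b, c])
    (by intro i _; fin_cases i <;> simpa) (by simp [Fin.sum_univ_three, h])
    (by intro i _; fin_cases i <;> simpa)
  simpa [Fin.sum_univ_three] using this

/-- A disc lies in a triangle when its radius is at most the distances of its centre, given in
barycentric coordinates, to the three sides. -/
lemma closedBall_subset_of_barycentric {K : Set Plane} (hc : Convex ℝ K) {a b c : Plane}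
    (ha : a ∈ K) (hb : b ∈ K) (hcK : c ∈ K) {α β γ ρ : ℝ} (h : α + β + γ = 1)
    (hD : cross (b - a) (c - a) ≠ 0)
    (hα : ρ * ‖b - c‖ ≤ α * |cross (b - a) (c - a)|)
    (hβ : ρ * ‖c - a‖ ≤ β * |cross (b - a) (c - a)|)
    (hγ : ρ * ‖b - a‖ ≤ γ * |cross (b - a) (c - a)|) :
    closedBall (α • a + β • b + γ • c) ρ ⊆ K := by
  intro y hy
  set D := cross (b - a) (c - a) with hDdef
  obtain ⟨v, rfl⟩ : ∃ v, y = α • a + β • b + γ • c + v := ⟨y - (α • a + β • b + γ • c), by abel⟩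
  rw [mem_closedBall, dist_eq_norm, add_sub_cancel_left] at hy
  -- Moving the point by `v` changes the barycentric coordinate opposite a side `w` by `cross v w /
  -- D`, so coordinates stay nonnegative throughout the disc.
  have key : ∀ (s : ℝ) (w : Plane), ρ * ‖w‖ ≤ s * |D| → 0 ≤ s + cross v w / D := by
    intro s w hs
    have h1 : |cross v w / D| ≤ s := by
      rw [abs_div, div_le_iff₀ (abs_pos.2 hD)]
      exact ((abs_cross_le v w).trans (mul_le_mul_of_nonneg_right hy (norm_nonneg w))).trans hs
    linarith [(abs_le.1 h1).1]
  have h1 := key α (b - c) hα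
  have h2 := key β (c - a) hβ
  have h3 := key γ (a - b) (by rwa [norm_sub_rev])
  have h4 : cross v (b - c) + cross v (c - a) + cross v (a - b) = 0 := by
    simp [cross]; ring
  have := convex_combination_mem hc ha hb hcK h1 h2 h3 (by
    have : (cross v (b - c) + cross v (c - a) + cross v (a - b)) / D = 0 := by rw [h4, zero_div]
    rw [add_div, add_div] at this
    linarith)
  convert this using 1
  have h5 : D • v = cross v (b - c) • a + cross v (c - a) • b + cross v (a - b) • c := by
    ext i
    fin_cases i <;> simp [hDdef, cross] <;> ring
  have h6 : v = (cross v (b - c) / D) • a + (cross v (c - a) / D) • b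
      + (cross v (a - b) / D) • c := by
    have h7 := inv_smul_smul₀ hD v
    rw [h5] at h7
    exact h7.symm.trans (by simp only [smul_add, smul_smul, div_eq_inv_mul])
  conv_lhs => rw [h6]
  module

/-! ### Discs inside convex bodies that are not contained in a thin rectangle -/

/-- Use a diameter `pq` as first axis: the projection of `K` on it is exactly the chord. If some `c`
in `K` is farther than `h` from its line, the triangle `pqc` has sides at most `d` and twice its
area exceeds `d h`, so its centroid is at least `h / 3` from each side. -/
lemma subset_rect_or_closedBall_subset {K : Set Plane} (hK : K ∈ convexBodies) {h : ℝ}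
    (hh : 0 < h) :
    (∃ (b : OrthonormalBasis (Fin 2) ℝ Plane) (l u : Fin 2 → ℝ), K ⊆ rect b l u ∧
      u 0 - l 0 = diam K ∧ u 1 - l 1 = 2 * h) ∨ ∃ x, closedBall x (h / 3) ⊆ K := by
  obtain ⟨p, hp, q, hq, hpq, hd⟩ := exists_dist_eq_diam hK
  set d := diam K
  obtain ⟨b, hb⟩ := exists_orthonormalBasis (e := d⁻¹ • (q - p)) (by
    rw [norm_smul, ← dist_eq_norm, dist_comm, hpq, Real.norm_eq_abs, abs_of_pos (inv_pos.2 hd),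
      inv_mul_cancel₀ hd.ne'])
  have hqp : q - p = d • b 0 := by rw [hb, smul_inv_smul₀ hd.ne']
  have hdist : ∀ x ∈ K, ∀ y ∈ K, ‖x - y‖ ≤ d := fun x hx y hy => by
    rw [← dist_eq_norm]
    exact dist_le_diam_of_mem hK.1.isBounded hx hy
  by_cases hcase : ∀ x ∈ K, |inner ℝ (b 1) (x - p)| ≤ h
  · left
    refine ⟨b, ![inner ℝ (b 0) p, inner ℝ (b 1) p - h], ![inner ℝ (b 0) p + d, inner ℝ (b 1) p + h],
      fun x hx i => ?_, by simp, by simp; ring⟩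
    fin_cases i
    · have h1 := (abs_le.1 ((abs_inner_basis_le b 0 (x - p)).trans (hdist x hx p hp))).2
      have h2 := (abs_le.1 ((abs_inner_basis_le b 0 (x - q)).trans (hdist x hx q hq))).1
      have e : x - q = (x - p) - d • b 0 := by rw [← hqp]; abel
      rw [e, inner_sub_right, inner_smul_right, real_inner_self_eq_norm_sq,
        b.orthonormal.1 0] at h2
      rw [inner_sub_right] at h1 h2
      simp only [Fin.zero_eta, Matrix.cons_val_zero, mem_Icc]
      constructor <;> linarith
    · have h1 := abs_le.1 (hcase x hx)
      rw [inner_sub_right] at h1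
      simp only [Fin.mk_one, Matrix.cons_val_one, Matrix.cons_val_zero, mem_Icc]
      constructor <;> linarith [h1.1, h1.2]
  · right
    push Not at hcase
    obtain ⟨c, hc, hlt⟩ := hcase
    have hcr : |cross (q - p) (c - p)| = d * |inner ℝ (b 1) (c - p)| := by
      rw [hqp, cross_smul_left, abs_mul, abs_of_pos hd, abs_cross_basis]
    have hpos : 0 < |cross (q - p) (c - p)| := by rw [hcr]; exact mul_pos hd (hh.trans hlt)
    have hle : ∀ x ∈ K, ∀ y ∈ K, h / 3 * ‖x - y‖ ≤ 1 / 3 * |cross (q - p) (c - p)| := by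
      intro x hx y hy
      have := hdist x hx y hy
      rw [hcr]
      nlinarith [norm_nonneg (x - y)]
    exact ⟨_, closedBall_subset_of_barycentric hK.2.1 hp hq hc (by norm_num) (abs_pos.1 hpos)
      (hle q hq c hc) (hle c hc p hp) (hle q hq p hp)⟩

/-- With `h = ω / 3` the rectangle has width `2ω / 3`, too thin for minimal width `ω`. -/
lemma exists_closedBall_of_minimalWidth {K : Set Plane} (hK : K ∈ convexBodies)
    (hω : 0 < minimalWidth K) : ∃ x, closedBall x (minimalWidth K / 9) ⊆ K := by
  rcases subset_rect_or_closedBall_subset hK (h := minimalWidth K / 3) (by positivity) with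
    ⟨b, l, u, hsub, -, hu⟩ | ⟨x, hx⟩
  · obtain ⟨-, -, -, h⟩ := exists_minimalWidth_direction hK
    obtain ⟨x, hx, y, hy, hw⟩ := h (b 1) (b.orthonormal.1 1)
    have h1 := (hsub hx 1).2
    have h2 := (hsub hy 1).1
    rw [real_inner_comm, inner_sub_right] at hw
    linarith
  · exact ⟨x, by convert hx using 2; ring⟩

/-- With `h = A / (4d)` the rectangle has area at most `A / 2`. -/
lemma exists_closedBall_of_volume {K : Set Plane} (hK : K ∈ convexBodies) {A d : ℝ} (hA : 0 < A)
    (hd : 0 < d) (hv : volume K = ENNReal.ofReal A) (hdiam : diam K ≤ d) :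
    ∃ x, closedBall x (A / (12 * d)) ⊆ K := by
  rcases subset_rect_or_closedBall_subset hK (h := A / (4 * d)) (by positivity) with
    ⟨b, l, u, hsub, hu0, hu⟩ | ⟨x, hx⟩
  · have h1 := measure_mono (μ := volume) hsub
    rw [volume_rect, hu0, hu, hv, ← ENNReal.ofReal_mul diam_nonneg,
      ENNReal.ofReal_le_ofReal_iff (by positivity)] at h1
    have h2 : diam K * (2 * (A / (4 * d))) ≤ d * (2 * (A / (4 * d))) := by gcongr
    have h3 : d * (2 * (A / (4 * d))) = A / 2 := by field_simp; norm_num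
    linarith
  · exact ⟨x, by convert hx using 2; field_simp; norm_num⟩

/-- With `h = (P - 2d) / 8` the rectangle has perimeter at most `2d + (P - 2d) / 2`, which is less
than `P`. -/
lemma exists_closedBall_of_perimeter {K : Set Plane} (hK : K ∈ convexBodies) {P d : ℝ}
    (hd : 2 * d < P) (hv : perimeter K = ENNReal.ofReal P) (hdiam : diam K ≤ d) :
    ∃ x, closedBall x ((P - 2 * d) / 24) ⊆ K := by
  rcases subset_rect_or_closedBall_subset hK (h := (P - 2 * d) / 8) (by linarith) with
    ⟨b, l, u, hsub, hu0, hu⟩ | ⟨x, hx⟩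
  · have hne := (convexBodies.nonempty hK).mono hsub
    have h1 := (perimeter_mono_of_convex hK.1.isClosed hK.2.1 (convexBodies.nonempty hK)
      (isClosed_rect b l u).measurableSet (isCompact_rect b l u).isBounded hsub).trans
      (perimeter_rect_le b (fun i => ?_) hne)
    · have := diam_nonneg (s := K)
      rw [hu0, hu, hv, ENNReal.ofReal_le_ofReal_iff (by nlinarith)] at h1
      linarith
    · obtain ⟨x, hx⟩ := hne
      exact (hx i).1.trans (hx i).2
  · exact ⟨x, by convert hx using 2; ring⟩

/-- A `d` by `s` rectangle with `s ^ 2 = R ^ 2 - (d / 2) ^ 2` has half-diagonal less than `R`, so it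
cannot contain a body of circumradius `R`. -/
lemma exists_closedBall_of_circumradius {K : Set Plane} (hK : K ∈ convexBodies)
    (hd : diam K < 2 * circumradius K) :
    ∃ x, closedBall x (√(circumradius K ^ 2 - (diam K / 2) ^ 2) / 6) ⊆ K := by
  set R := circumradius K
  set d := diam K
  have hd0 : 0 ≤ d := diam_nonneg
  have hpos : 0 < R ^ 2 - (d / 2) ^ 2 := by nlinarith
  have hs := Real.sq_sqrt hpos.le
  have hs0 := Real.sqrt_pos.2 hpos
  set s := √(R ^ 2 - (d / 2) ^ 2)
  rcases subset_rect_or_closedBall_subset hK (h := s / 2) (by positivity) with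
    ⟨b, l, u, hsub, hu0, hu⟩ | ⟨x, hx⟩
  · exfalso
    let z : Plane := ((l 0 + u 0) / 2) • b 0 + ((l 1 + u 1) / 2) • b 1
    have hz0 : inner ℝ (b 0) z = (l 0 + u 0) / 2 := by
      simp [z, inner_add_right, inner_smul_right, b.inner_eq_ite]
    have hz1 : inner ℝ (b 1) z = (l 1 + u 1) / 2 := by
      simp [z, inner_add_right, inner_smul_right, b.inner_eq_ite]
    have hKz : K ⊆ closedBall z √((d / 2) ^ 2 + (s / 2) ^ 2) := by
      intro x hx
      rw [mem_closedBall, dist_eq_norm]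
      apply Real.le_sqrt_of_sq_le
      rw [sq_norm_eq_inner_basis b, inner_sub_right, inner_sub_right, hz0, hz1]
      have h0 := hsub hx 0
      have h1 := hsub hx 1
      have e0 : |inner ℝ (b 0) x - (l 0 + u 0) / 2| ≤ d / 2 :=
        abs_le.2 ⟨by linarith [h0.1], by linarith [h0.2]⟩
      have e1 : |inner ℝ (b 1) x - (l 1 + u 1) / 2| ≤ s / 2 :=
        abs_le.2 ⟨by linarith [h1.1], by linarith [h1.2]⟩
      exact add_le_add (sq_le_sq' (abs_le.1 e0).1 (abs_le.1 e0).2)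
        (sq_le_sq' (abs_le.1 e1).1 (abs_le.1 e1).2)
    have h1 := circumradius_le hK hKz
    have h2 : √((d / 2) ^ 2 + (s / 2) ^ 2) < R := by
      rw [Real.sqrt_lt' (by linarith)]
      nlinarith
    exact absurd h1 (not_le.2 h2)
  · exact ⟨x, by convert hx using 2; ring⟩

/-! ### Diameter bounds -/

lemma diam_le_two_mul_circumradius {K : Set Plane} (hK : K ∈ convexBodies) :
    diam K ≤ 2 * circumradius K := by
  rw [← div_le_iff₀' two_pos]
  refine le_of_forall_gt fun ρ hρ => ?_
  obtain ⟨ρ', h1, h2⟩ := exists_between hρ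
  obtain ⟨z, hz⟩ := exists_subset_closedBall_of_circumradius_lt hK h1
  have h3 := (diam_mono hz isBounded_closedBall).trans
    (diam_closedBall ((circumradius_nonneg K).trans h1.le))
  linarith

lemma exists_far_point {K : Set Plane} (hK : K ∈ convexBodies) (x : Plane) :
    ∃ p ∈ K, diam K / 2 ≤ dist p x := by
  obtain ⟨a, ha, b, hb, hab, -⟩ := exists_dist_eq_diam hK
  by_contra! h
  have h1 := h a ha
  have h2 := h b hb
  linarith [dist_triangle_right a b x]

lemma diam_le_of_volume {K : Set Plane} (hK : K ∈ convexBodies) {x : Plane} {ρ A : ℝ} (hρ : 0 < ρ)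
    (hA : 0 ≤ A) (hx : closedBall x ρ ⊆ K) (hv : volume K = ENNReal.ofReal A) :
    diam K ≤ 4 * A / ρ := by
  obtain ⟨p, hp, hpx⟩ := exists_far_point hK x
  obtain ⟨-, -, -, -, -, hpos⟩ := exists_dist_eq_diam hK
  have h := le_volume_of_closedBall_subset hK hρ hx hp (by linarith)
  rw [hv, ENNReal.ofReal_le_ofReal_iff hA] at h
  rw [le_div_iff₀ hρ]
  nlinarith

lemma diam_le_of_perimeter {K : Set Plane} (hK : K ∈ convexBodies) {x : Plane} {ρ P : ℝ}
    (hρ : 0 < ρ) (hP : 0 ≤ P) (hx : closedBall x ρ ⊆ K)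
    (hv : perimeter K = ENNReal.ofReal P) : diam K ≤ 8 * P := by
  obtain ⟨p, hp, hpx⟩ := exists_far_point hK x
  obtain ⟨-, -, -, -, -, hpos⟩ := exists_dist_eq_diam hK
  have h := le_perimeter_of_closedBall_subset hK hρ hx hp (by linarith)
  rw [hv, ENNReal.ofReal_le_ofReal_iff hP] at h
  linarith

/-- A convex body contains a chord of length its minimal width in every direction. -/
lemma exists_chord_eq_minimalWidth_smul {K : Set Plane} (hK : K ∈ convexBodies) {v : Plane}
    (hv : ‖v‖ = 1) : ∃ p ∈ K, ∃ q ∈ K, p - q = minimalWidth K • v := by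
  by_contra! h
  have hne := convexBodies.nonempty hK
  -- The support function of `K - K` is the width of `K`, hence at least the minimal width on unit
  -- vectors; no line separates this vector from `K - K`.
  have hmem : minimalWidth K • v ∉ K - K := by
    rintro ⟨p, hp, q, hq, e⟩
    exact h p hp q hq e
  have hcomp : IsCompact (K - K) := by
    rw [sub_eq_add_neg]
    exact hK.1.add hK.1.neg
  obtain ⟨n, hn, c, hlt, hle⟩ := exists_separating_halfPlane hcomp.isClosed
    (hK.2.1.sub hK.2.1) (hne.sub hne) hmem
  obtain ⟨-, -, -, hw⟩ := exists_minimalWidth_direction hK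
  obtain ⟨x, hx, y, hy, hxy⟩ := hw n hn
  have h1 := hle (x - y) (sub_mem_sub hx hy)
  have h2 : inner ℝ (minimalWidth K • v) n ≤ minimalWidth K := by
    rw [real_inner_smul_left]
    have : inner ℝ v n ≤ 1 := (real_inner_le_norm v n).trans (by rw [hv, hn, one_mul])
    exact mul_le_of_le_one_right (minimalWidth_nonneg hK) this
  linarith

/-- Take a chord `pq` of length `ω` in the direction of minimal width. A point of `K` far from it
spans with it a long triangle whose inradius is close to `ω / 2`, hence exceeds `ρ`, against the
bound on the inradius of `K`. -/
lemma diam_le_of_inradius_lt {K : Set Plane} (hK : K ∈ convexBodies) {ρ : ℝ}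
    (hr : inradius K < ρ) (hρ : 2 * ρ < minimalWidth K) :
    diam K ≤ minimalWidth K + 2 * (3 * ρ * minimalWidth K / (minimalWidth K - 2 * ρ)) := by
  by_contra! hlt
  set ω := minimalWidth K
  -- The threshold in `hkey`: `ρ (D + ω) ≤ ω (D - ρ) / 2` is equivalent to `D ≥ D₀`.
  set D₀ := 3 * ρ * ω / (ω - 2 * ρ) with hD₀
  have hρ0 : 0 < ρ := (inradius_nonneg K).trans_lt hr
  have hω0 : 0 < ω := by linarith
  have hD₀pos : 0 < D₀ := div_pos (by positivity) (by linarith)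
  obtain ⟨u, hu, hwu, -⟩ := exists_minimalWidth_direction hK
  obtain ⟨p, hp, q, hq, hpq⟩ := exists_chord_eq_minimalWidth_smul hK hu
  obtain ⟨b, hb⟩ := exists_orthonormalBasis hu
  obtain ⟨x₁, hx₁, x₂, hx₂, hdist, -⟩ := exists_dist_eq_diam hK
  have hnorm : ∀ x ∈ K, ∀ y ∈ K, ‖x - y‖ ≤ |inner ℝ (b 1) (x - y)| + ω := by
    intro x hx y hy
    have h1 : |inner ℝ (b 0) (x - y)| ≤ ω := by
      rw [hb, real_inner_comm, abs_le]
      have h2 := hwu x hx y hy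
      have h3 := hwu y hy x hx
      rw [← neg_sub, inner_neg_left] at h3
      exact ⟨by linarith, h2⟩
    apply abs_le_of_sq_le_sq' _ (by positivity) |>.2
    rw [sq_norm_eq_inner_basis b, ← sq_abs (inner ℝ (b 0) (x - y)),
      ← sq_abs (inner ℝ (b 1) (x - y))]
    nlinarith [abs_nonneg (inner ℝ (b 0) (x - y)), abs_nonneg (inner ℝ (b 1) (x - y))]
  obtain ⟨x, hx, hxD⟩ : ∃ x ∈ K, D₀ ≤ |inner ℝ (b 1) (x - q)| := by
    by_contra! h
    have h1 := h x₁ hx₁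
    have h2 := h x₂ hx₂
    have h3 := hnorm x₁ hx₁ x₂ hx₂
    rw [← dist_eq_norm, hdist] at h3
    have e : x₁ - x₂ = (x₁ - q) - (x₂ - q) := by abel
    rw [e, inner_sub_right] at h3
    have h4 := abs_sub (inner ℝ (b 1) (x₁ - q)) (inner ℝ (b 1) (x₂ - q))
    linarith
  set D := |inner ℝ (b 1) (x - q)| with hDdef
  have hDpos : 0 < D := hD₀pos.trans_le hxD
  have hcr : |cross (p - q) (x - q)| = ω * D := by
    rw [hpq, cross_smul_left, abs_mul, abs_of_pos hω0, ← hb, abs_cross_basis]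
  have hxq : ‖x - q‖ ≤ D + ω := hnorm x hx q hq
  have hxp : ‖p - x‖ ≤ D + ω := by
    rw [norm_sub_rev]
    refine (hnorm x hx p hp).trans (le_of_eq ?_)
    have e : x - p = (x - q) - ω • b 0 := by rw [hb, ← hpq]; abel
    rw [e, inner_sub_right, inner_smul_right, b.inner_eq_ite]
    simp [hDdef]
  have hkey : ρ * (D + ω) ≤ (1 - ρ / D) / 2 * (ω * D) := by
    have h1 : (1 - ρ / D) / 2 * (ω * D) = ω * (D - ρ) / 2 := by field_simp
    rw [h1]
    rw [hD₀, div_le_iff₀ (by linarith)] at hxD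
    nlinarith
  -- Weight `ρ / D` at `x` puts the centre at distance exactly `ρ` from the chord; the rest is split
  -- equally between its endpoints.
  have hsub := closedBall_subset_of_barycentric hK.2.1 hq hp hx
    (α := (1 - ρ / D) / 2) (β := (1 - ρ / D) / 2) (γ := ρ / D) (ρ := ρ) (by ring)
    (abs_pos.1 (by rw [hcr]; positivity))
    (by rw [hcr]; exact (mul_le_mul_of_nonneg_left hxp hρ0.le).trans hkey)
    (by rw [hcr]; exact (mul_le_mul_of_nonneg_left hxq hρ0.le).trans hkey)
    (by
      rw [hcr, hpq, norm_smul, hu, Real.norm_eq_abs, abs_of_pos hω0]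
      exact le_of_eq (by field_simp))
  exact absurd (le_inradius hK hρ0.le hsub) (not_le.2 hr)

/-! ### Barrels: a disc cut by a symmetric strip -/

/-- The intersection of the disc of radius `ρ` with the strip of half-width `s`. -/
def barrel (ρ s : ℝ) : Set Plane := closedBall 0 ρ ∩ {x | |x 1| ≤ s}

lemma abs_coord_le_norm (x : Plane) (i : Fin 2) : |x i| ≤ ‖x‖ := by
  simpa using PiLp.norm_apply_le x i

lemma closedBall_subset_barrel {ρ s : ℝ} (h : s ≤ ρ) : closedBall 0 s ⊆ barrel ρ s := fun x hx =>
  ⟨closedBall_subset_closedBall h hx,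
    (abs_coord_le_norm x 1).trans (mem_closedBall_zero_iff.1 hx)⟩

lemma barrel_self (ρ : ℝ) : barrel ρ ρ = closedBall 0 ρ :=
  Subset.antisymm inter_subset_left (closedBall_subset_barrel le_rfl)

lemma barrel_mem_convexBodies {ρ s : ℝ} (hs : 0 < s) (h : s ≤ ρ) : barrel ρ s ∈ convexBodies := by
  refine mem_convexBodies_of_closedBall_subset ?_ ?_ hs (closedBall_subset_barrel h)
  · exact (isCompact_closedBall 0 ρ).inter_right (isClosed_le (by fun_prop) continuous_const)
  · refine (convex_closedBall 0 ρ).inter ?_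
    have : {x : Plane | |x 1| ≤ s} = (EuclideanSpace.proj 1 : Plane →L[ℝ] ℝ) ⁻¹' Icc (-s) s := by
      ext x
      simp [abs_le]
    rw [this]
    exact (convex_Icc (-s) s).linear_preimage (EuclideanSpace.proj 1 : Plane →L[ℝ] ℝ).toLinearMap

lemma tip_mem_barrel {ρ s a : ℝ} (hs : 0 ≤ s) (ha : |a| ≤ ρ) :
    EuclideanSpace.single 0 a ∈ barrel ρ s := by
  refine ⟨?_, ?_⟩
  · rw [mem_closedBall_zero_iff]
    simpa using ha
  · simpa using hs

lemma diam_barrel {ρ s : ℝ} (hs : 0 < s) (h : s ≤ ρ) : diam (barrel ρ s) = 2 * ρ := by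
  have hρ : 0 ≤ ρ := hs.le.trans h
  apply le_antisymm
  · exact (diam_mono inter_subset_left isBounded_closedBall).trans (diam_closedBall hρ)
  · have h1 := dist_le_diam_of_mem (barrel_mem_convexBodies hs h).1.isBounded
      (tip_mem_barrel (a := ρ) hs.le (abs_of_nonneg hρ).le)
      (tip_mem_barrel (a := -ρ) hs.le (by rw [abs_neg, abs_of_nonneg hρ]))
    rw [PiLp.dist_single_same, Real.dist_eq, sub_neg_eq_add,
      abs_of_nonneg (by positivity)] at h1
    linarith

lemma circumradius_barrel {ρ s : ℝ} (hs : 0 < s) (h : s ≤ ρ) : circumradius (barrel ρ s) = ρ := by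
  refine circumradius_eq (barrel_mem_convexBodies hs h) (x := 0) inter_subset_left fun z ρ' hz => ?_
  have hne : 0 ≤ ρ' := dist_nonneg.trans
    (mem_closedBall.1 (hz (closedBall_subset_barrel h (mem_closedBall_self hs.le))))
  have h1 := (diam_mono hz isBounded_closedBall).trans (diam_closedBall hne)
  rw [diam_barrel hs h] at h1
  linarith

lemma inradius_barrel {ρ s : ℝ} (hs : 0 < s) (h : s ≤ ρ) : inradius (barrel ρ s) = s := by
  refine inradius_eq (barrel_mem_convexBodies hs h) hs.le (closedBall_subset_barrel h)
    fun y a ha hy => ?_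
  have hmem : ∀ c : ℝ, |c| ≤ a → |y 1 + c| ≤ s := by
    intro c hc
    have h1 : y + EuclideanSpace.single 1 c ∈ closedBall y a := by
      rw [mem_closedBall, dist_eq_norm, add_sub_cancel_left]
      simpa using hc
    have h2 := (hy h1).2
    simpa using h2
  have h1 := (abs_le.1 (hmem a (abs_of_nonneg ha).le)).2
  have h2 := (abs_le.1 (hmem (-a) (by rw [abs_neg, abs_of_nonneg ha]))).1
  linarith

lemma le_minimalWidth_of_closedBall_subset {K : Set Plane} (hK : K ∈ convexBodies) {x : Plane}
    {ρ : ℝ} (hρ : 0 ≤ ρ) (h : closedBall x ρ ⊆ K) : 2 * ρ ≤ minimalWidth K := by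
  refine le_minimalWidth hK fun v hv => ⟨x + ρ • v, h ?_, x - ρ • v, h ?_, ?_⟩
  · rw [mem_closedBall, dist_eq_norm, add_sub_cancel_left, norm_smul, hv, mul_one,
      Real.norm_eq_abs, abs_of_nonneg hρ]
  · rw [mem_closedBall, dist_comm, dist_eq_norm, sub_sub_cancel, norm_smul, hv, mul_one,
      Real.norm_eq_abs, abs_of_nonneg hρ]
  · have : x + ρ • v - (x - ρ • v) = (2 * ρ) • v := by module
    rw [this, real_inner_smul_left, real_inner_self_eq_norm_sq, hv]
    simp

lemma minimalWidth_barrel {ρ s : ℝ} (hs : 0 < s) (h : s ≤ ρ) :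
    minimalWidth (barrel ρ s) = 2 * s := by
  have hK := barrel_mem_convexBodies hs h
  apply le_antisymm
  · refine minimalWidth_le hK (u := EuclideanSpace.single 1 1) (by simp) fun x hx y hy => ?_
    have h1 := abs_le.1 (show |x 1| ≤ s from hx.2)
    have h2 := abs_le.1 (show |y 1| ≤ s from hy.2)
    rw [inner_eq_coord]
    simp
    linarith
  · exact le_minimalWidth_of_closedBall_subset hK hs.le (closedBall_subset_barrel h)

/-- Enlarging one parameter alone stays inside the full homothety. This and its companion for `s`
give the growth bounds used for intermediate values. -/
lemma barrel_mul_left_subset {ρ s t : ℝ} (ht : 1 ≤ t) (hs : 0 ≤ s) :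
    barrel (t * ρ) s ⊆ dilate 0 t '' barrel ρ s := by
  have ht0 : 0 < t := by linarith
  intro x hx
  refine ⟨t⁻¹ • x, ⟨?_, ?_⟩, by simp [dilate, smul_smul, ht0.ne']⟩
  · have := mem_closedBall_zero_iff.1 hx.1
    rwa [mem_closedBall_zero_iff, norm_smul, Real.norm_eq_abs, abs_of_pos (inv_pos.2 ht0),
      inv_mul_le_iff₀ ht0]
  · have : |x 1| ≤ s := hx.2
    show |(t⁻¹ • x) 1| ≤ s
    simp only [PiLp.smul_apply, smul_eq_mul, abs_mul, abs_of_pos (inv_pos.2 ht0)]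
    rw [inv_mul_le_iff₀ ht0]
    nlinarith

lemma barrel_mul_right_subset {ρ s t : ℝ} (ht : 1 ≤ t) (hρ : 0 ≤ ρ) :
    barrel ρ (t * s) ⊆ dilate 0 t '' barrel ρ s := by
  have ht0 : 0 < t := by linarith
  intro x hx
  refine ⟨t⁻¹ • x, ⟨?_, ?_⟩, by simp [dilate, smul_smul, ht0.ne']⟩
  · have := mem_closedBall_zero_iff.1 hx.1
    rw [mem_closedBall_zero_iff, norm_smul, Real.norm_eq_abs, abs_of_pos (inv_pos.2 ht0),
      inv_mul_le_iff₀ ht0]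
    nlinarith
  · have : |x 1| ≤ t * s := hx.2
    show |(t⁻¹ • x) 1| ≤ s
    simp only [PiLp.smul_apply, smul_eq_mul, abs_mul, abs_of_pos (inv_pos.2 ht0)]
    rwa [inv_mul_le_iff₀ ht0]

lemma barrel_subset_rect (ρ s : ℝ) :
    barrel ρ s ⊆ rect (EuclideanSpace.basisFun (Fin 2) ℝ) ![-ρ, -s] ![ρ, s] := by
  intro x hx i
  fin_cases i
  · have := abs_le.1 ((abs_coord_le_norm x 0).trans (mem_closedBall_zero_iff.1 hx.1))
    simpa [inner_eq_coord] using this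
  · have := abs_le.1 (show |x 1| ≤ s from hx.2)
    simpa [inner_eq_coord] using this

lemma volume_barrel_le {ρ s : ℝ} (hρ : 0 ≤ ρ) :
    volume (barrel ρ s) ≤ ENNReal.ofReal (4 * ρ * s) := by
  refine (measure_mono (barrel_subset_rect ρ s)).trans ?_
  rw [volume_rect, ← ENNReal.ofReal_mul (by simpa using hρ)]
  apply ENNReal.ofReal_le_ofReal
  simp
  linarith

lemma perimeter_barrel_le {ρ s : ℝ} (hs : 0 < s) (h : s ≤ ρ) :
    perimeter (barrel ρ s) ≤ ENNReal.ofReal (4 * ρ + 4 * s) := by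
  have hK := barrel_mem_convexBodies hs h
  have hne := convexBodies.nonempty hK
  have hsub := barrel_subset_rect ρ s
  refine (perimeter_mono_of_convex hK.1.isClosed hK.2.1 hne (isClosed_rect _ _ _).measurableSet
    (isCompact_rect _ _ _).isBounded hsub).trans
    ((perimeter_rect_le _ (fun i => ?_) (hne.mono hsub)).trans ?_)
  · fin_cases i <;> simp <;> linarith
  · apply ENNReal.ofReal_le_ofReal
    simp
    linarith

/-! ### Intermediate values along families of barrels -/

/-- An intermediate value theorem for functions of subpolynomial growth ratio. -/
lemma exists_eq_of_le_pow_mul {f : ℝ → ENNReal} {a b : ℝ} {k : ℕ} {y : ENNReal} (ha : 0 < a)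
    (hab : a ≤ b) (hf : ∀ x ∈ Icc a b, ∀ t : ℝ, 1 ≤ t → t * x ∈ Icc a b →
      f (t * x) ≤ ENNReal.ofReal t ^ k * f x)
    (hfa : f a ≤ y) (hfb : y ≤ f b) : ∃ x ∈ Icc a b, f x = y := by
  -- The supremum `s` of this sublevel set works: the growth bound compares `f s` with values at
  -- most `y` just below `s`, and with values above `y` just beyond it.
  set S : Set ℝ := {x ∈ Icc a b | f x ≤ y} with hS
  have haS : a ∈ S := ⟨left_mem_Icc.2 hab, hfa⟩
  have hbdd : BddAbove S := ⟨b, fun x hx => hx.1.2⟩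
  set s := sSup S
  have has : a ≤ s := le_csSup hbdd haS
  have hsb : s ≤ b := csSup_le ⟨a, haS⟩ fun x hx => hx.1.2
  have hs0 : 0 < s := ha.trans_le has
  refine ⟨s, ⟨has, hsb⟩, le_antisymm ?_ ?_⟩
  · refine le_of_forall_le_ofReal_pow_mul (k := k) fun t ht => ?_
    have ht0 : 0 < t := by linarith
    obtain ⟨x, hx, hlt⟩ := exists_lt_of_lt_csSup ⟨a, haS⟩ (div_lt_self hs0 ht)
    have hx0 : 0 < x := ha.trans_le hx.1.1
    have hxs : x ≤ s := le_csSup hbdd hx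
    have e : s / x * x = s := div_mul_cancel₀ s hx0.ne'
    have h1 := hf x hx.1 (s / x) ((one_le_div hx0).2 hxs) (by rw [e]; exact ⟨has, hsb⟩)
    rw [e] at h1
    refine h1.trans ?_
    have h2 : s / x ≤ t := by
      rw [div_le_iff₀ hx0]
      rw [div_lt_iff₀ ht0] at hlt
      linarith
    gcongr
    exact hx.2
  · rcases hsb.eq_or_lt with heq | hlt
    · rw [heq]; exact hfb
    refine le_of_forall_le_ofReal_pow_mul (k := k) fun t ht => ?_
    -- The factor is capped so that the point beyond `s` stays in the interval.
    have h1 : 1 < min t (b / s) := lt_min ht ((one_lt_div hs0).2 hlt)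
    have h2 : min t (b / s) * s ≤ b := by
      rw [← le_div_iff₀ hs0]; exact min_le_right _ _
    have h3 : s < min t (b / s) * s := by nlinarith
    have hmem : min t (b / s) * s ∈ Icc a b := ⟨has.trans h3.le, h2⟩
    have h4 : y < f (min t (b / s) * s) := by
      by_contra! hle
      exact absurd (le_csSup hbdd (⟨hmem, hle⟩ : _ ∈ S)) (not_le.2 h3)
    refine h4.le.trans ((hf s ⟨has, hsb⟩ _ h1.le hmem).trans ?_)
    gcongr
    exact min_le_left _ _

/-- At `ρ = r` the barrel is a disc of perimeter `2πr`; at `ρ = 4P` its tip is at distance `4P` from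
the centre, which forces perimeter at least `P`. -/
lemma exists_barrel_perimeter_eq_of_halfWidth {r P : ℝ} (hr : 0 < r) (h : 2 * Real.pi * r ≤ P) :
    ∃ ρ, r ≤ ρ ∧ perimeter (barrel ρ r) = ENNReal.ofReal P := by
  have hpi := Real.pi_gt_three
  have hle : r ≤ 4 * P := by nlinarith
  obtain ⟨ρ, hρ, e⟩ : ∃ ρ ∈ Icc r (4 * P), perimeter (barrel ρ r) = ENNReal.ofReal P := by
    refine exists_eq_of_le_pow_mul (f := fun ρ => perimeter (barrel ρ r)) (k := 1) hr hle
      (fun x hx t ht htx => ?_) ?_ ?_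
    · exact homogeneousMonotone_perimeter _ (barrel_mem_convexBodies hr htx.1) _
        (barrel_mem_convexBodies hr hx.1) 0 t (by linarith) (barrel_mul_left_subset ht hr.le)
    · simp only [barrel_self, perimeter_closedBall hr]
      exact ENNReal.ofReal_le_ofReal h
    · have hP : 0 < 4 * P := hr.trans_le hle
      have hd : dist (EuclideanSpace.single 0 (4 * P) : Plane) 0 = 4 * P := by
        simpa using hP.le
      have := le_perimeter_of_closedBall_subset (barrel_mem_convexBodies hr hle) hr
        (closedBall_subset_barrel hle)
        (tip_mem_barrel (a := 4 * P) hr.le (abs_of_pos hP).le) (by rw [hd]; exact hP)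
      rw [hd] at this
      convert this using 2
      ring
  exact ⟨ρ, hρ.1, e⟩

/-- At half-width at most `(P - 4R) / 4` the bounding rectangle has perimeter at most `P`; at
half-width `R` the barrel is the full disc. -/
lemma exists_barrel_perimeter_eq_of_radius {R P : ℝ} (hR : 0 < R) (h : 4 * R < P)
    (h' : P ≤ 2 * Real.pi * R) :
    ∃ s, 0 < s ∧ s ≤ R ∧ perimeter (barrel R s) = ENNReal.ofReal P := by
  have ha : 0 < min R ((P - 4 * R) / 4) := lt_min hR (by linarith)
  obtain ⟨s, hs, e⟩ : ∃ s ∈ Icc (min R ((P - 4 * R) / 4)) R, perimeter (barrel R s) = ENNReal.ofReal P := by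
    refine exists_eq_of_le_pow_mul (f := fun s => perimeter (barrel R s)) (k := 1) ha (min_le_left _ _)
      (fun x hx t ht htx => ?_) ?_ ?_
    · exact homogeneousMonotone_perimeter _ (barrel_mem_convexBodies (ha.trans_le htx.1) htx.2) _
        (barrel_mem_convexBodies (ha.trans_le hx.1) hx.2) 0 t (by linarith)
        (barrel_mul_right_subset ht hR.le)
    · refine (perimeter_barrel_le ha (min_le_left _ _)).trans (ENNReal.ofReal_le_ofReal ?_)
      linarith [min_le_right R ((P - 4 * R) / 4)]
    · simp only [barrel_self, perimeter_closedBall hR]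
      exact ENNReal.ofReal_le_ofReal h'
  exact ⟨s, ha.trans_le hs.1, hs.2, e⟩

lemma exists_barrel_volume_eq {R A : ℝ} (hR : 0 < R) (hA : 0 < A) (h : A ≤ Real.pi * R ^ 2) :
    ∃ s, 0 < s ∧ s ≤ R ∧ volume (barrel R s) = ENNReal.ofReal A := by
  have ha : 0 < min R (A / (4 * R)) := lt_min hR (by positivity)
  obtain ⟨s, hs, e⟩ : ∃ s ∈ Icc (min R (A / (4 * R))) R, volume (barrel R s) = ENNReal.ofReal A := by
    refine exists_eq_of_le_pow_mul (f := fun s => volume (barrel R s)) (k := 2) ha (min_le_left _ _)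
      (fun x hx t ht htx => ?_) ?_ ?_
    · exact homogeneousMonotone_volume _ (barrel_mem_convexBodies (ha.trans_le htx.1) htx.2) _
        (barrel_mem_convexBodies (ha.trans_le hx.1) hx.2) 0 t (by linarith)
        (barrel_mul_right_subset ht hR.le)
    · refine (volume_barrel_le hR.le).trans (ENNReal.ofReal_le_ofReal ?_)
      have := min_le_right R (A / (4 * R))
      rw [le_div_iff₀ (by positivity)] at this
      linarith
    · simp only [barrel_self, volume_closedBall_eq _ hR.le]
      exact ENNReal.ofReal_le_ofReal h
  exact ⟨s, ha.trans_le hs.1, hs.2, e⟩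

/-! ### Isosceles triangles and trapezoids -/

lemma abs_cross_le_of_unit {v : Plane} (hv : ‖v‖ = 1) (x y : Plane) :
    |cross x y| ≤ |inner ℝ x v| * ‖y‖ + |inner ℝ y v| * ‖x‖ := by
  have h1 : cross x y = inner ℝ x v * cross v y + inner ℝ y v * cross x v := by
    have h2 : v 0 ^ 2 + v 1 ^ 2 = 1 := by rw [← norm_sq_eq_coord, hv, one_pow]
    rw [inner_eq_coord, inner_eq_coord]
    unfold cross
    linear_combination (y 0 * x 1 - x 0 * y 1) * h2
  rw [h1]
  refine (abs_add_le _ _).trans ?_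
  rw [abs_mul, abs_mul]
  have h3 := abs_cross_le v y
  have h4 := abs_cross_le x v
  rw [hv, one_mul] at h3
  rw [hv, mul_one] at h4
  gcongr

/-- The minimal width of a triangle is at least twice its area divided by its longest side. -/
lemma le_minimalWidth_of_triangle {K : Set Plane} (hK : K ∈ convexBodies) {a b c : Plane}
    (ha : a ∈ K) (hb : b ∈ K) (hc : c ∈ K) {s ω : ℝ} (hs : 0 < s) (hab : ‖b - a‖ ≤ s)
    (hbc : ‖c - b‖ ≤ s) (hca : ‖a - c‖ ≤ s) (h : ω * s ≤ |cross (b - a) (c - a)|) :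
    ω ≤ minimalWidth K := by
  refine le_minimalWidth hK fun v hv => ?_
  -- Here `m` is the vertex with the middle projection on `v`. Decomposing the two edges at `m`
  -- along `v` bounds twice the area by `s` times the extent of the triangle along `v`.
  have key : ∀ m ∈ K, ∀ x ∈ K, ∀ y ∈ K, ‖x - m‖ ≤ s → ‖y - m‖ ≤ s →
      ω * s ≤ |cross (x - m) (y - m)| → inner ℝ m v ≤ inner ℝ x v → inner ℝ y v ≤ inner ℝ m v →
      ∃ x ∈ K, ∃ y ∈ K, ω ≤ inner ℝ (x - y) v := by
    intro m _ x hx y hy hxm hym hcr h1 h2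
    refine ⟨x, hx, y, hy, ?_⟩
    have h3 := abs_cross_le_of_unit hv (x - m) (y - m)
    rw [inner_sub_left, inner_sub_left, abs_of_nonneg (sub_nonneg.2 h1),
      abs_of_nonpos (sub_nonpos.2 h2)] at h3
    rw [inner_sub_left]
    have h4 : (inner ℝ x v - inner ℝ m v) * ‖y - m‖ ≤ (inner ℝ x v - inner ℝ m v) * s :=
      mul_le_mul_of_nonneg_left hym (sub_nonneg.2 h1)
    have h5 : -(inner ℝ y v - inner ℝ m v) * ‖x - m‖ ≤ -(inner ℝ y v - inner ℝ m v) * s :=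
      mul_le_mul_of_nonneg_left hxm (by linarith)
    have h6 : ω * s ≤ (inner ℝ x v - inner ℝ y v) * s := by linarith
    exact le_of_mul_le_mul_right h6 hs
  have hba : ‖a - b‖ ≤ s := by rwa [norm_sub_rev]
  have hcb : ‖b - c‖ ≤ s := by rwa [norm_sub_rev]
  have hac : ‖c - a‖ ≤ s := by rwa [norm_sub_rev]
  have ea : cross (b - a) (c - a) = -cross (c - a) (b - a) := by simp [cross]; ring
  have eb : cross (b - a) (c - a) = cross (c - b) (a - b) := by simp [cross]; ring
  have eb' : cross (b - a) (c - a) = -cross (a - b) (c - b) := by simp [cross]; ring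
  have ec : cross (b - a) (c - a) = cross (a - c) (b - c) := by simp [cross]; ring
  have ec' : cross (b - a) (c - a) = -cross (b - c) (a - c) := by simp [cross]; ring
  rcases le_total (inner ℝ a v) (inner ℝ b v) with h1 | h1 <;>
  rcases le_total (inner ℝ b v) (inner ℝ c v) with h2 | h2 <;>
  rcases le_total (inner ℝ a v) (inner ℝ c v) with h3 | h3
  · exact key b hb c hc a ha hbc hba (by rwa [← eb]) h2 h1
  · exact key b hb c hc a ha hbc hba (by rwa [← eb]) h2 h1
  · exact key c hc b hb a ha hcb hca (by rwa [← abs_neg, ← ec']) h2 h3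
  · exact key a ha b hb c hc hab hac h h1 h3
  · exact key a ha c hc b hb hac hab (by rwa [← abs_neg, ← ea]) h3 h1
  · exact key c hc a ha b hb hca hcb (by rwa [← ec]) h3 h2
  · exact key b hb a ha c hc hba hbc (by rwa [← abs_neg, ← eb']) h1 h2
  · exact key b hb a ha c hc hba hbc (by rwa [← abs_neg, ← eb']) h1 h2

/-- The isosceles triangle with base `s` and height `ω`, the height being measured along the first
axis, widened to a trapezoid by a translation of length `τ` along its base. -/
def trapezoid (ω s τ : ℝ) : Set Plane :=
  {x | 0 ≤ x 0 ∧ x 0 ≤ ω ∧ -(s / 2 * (1 - x 0 / ω)) ≤ x 1 ∧ x 1 ≤ s / 2 * (1 - x 0 / ω) + τ}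

lemma isClosed_trapezoid (ω s τ : ℝ) : IsClosed (trapezoid ω s τ) := by
  refine IsClosed.and ?_ (IsClosed.and ?_ (IsClosed.and ?_ ?_)) <;>
  exact isClosed_le (by fun_prop) (by fun_prop)

lemma isCompact_trapezoid {ω s τ : ℝ} (hω : 0 < ω) (hs : 0 < s) :
    IsCompact (trapezoid ω s τ) := by
  refine (isCompact_rect (EuclideanSpace.basisFun (Fin 2) ℝ) ![0, -(s / 2)] ![ω, s / 2 + τ]
    ).of_isClosed_subset (isClosed_trapezoid ω s τ) fun x hx i => ?_
  have h1 : 0 ≤ x 0 / ω := div_nonneg hx.1 hω.le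
  obtain ⟨h2, h3, h4, h5⟩ := hx
  fin_cases i
  · simpa [inner_eq_coord] using ⟨h2, h3⟩
  · simp [inner_eq_coord]
    constructor <;> nlinarith

lemma convex_trapezoid (ω s τ : ℝ) : Convex ℝ (trapezoid ω s τ) := by
  intro x hx y hy a b ha hb hab
  obtain ⟨x1, x2, x3, x4⟩ := hx
  obtain ⟨y1, y2, y3, y4⟩ := hy
  have hb' : b = 1 - a := by linarith
  have e : 1 - (a * x 0 + b * y 0) / ω = a * (1 - x 0 / ω) + b * (1 - y 0 / ω) := by
    rw [hb']; ring
  refine ⟨?_, ?_, ?_, ?_⟩ <;> simp only [PiLp.add_apply, PiLp.smul_apply, smul_eq_mul]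
  · positivity
  · nlinarith
  · rw [e]; nlinarith
  · rw [e]
    have h1 := mul_le_mul_of_nonneg_left x4 ha
    have h2 := mul_le_mul_of_nonneg_left y4 hb
    have h3 : a * τ + b * τ = τ := by rw [← add_mul, hab, one_mul]
    linarith

lemma base_left_mem_trapezoid {ω s τ : ℝ} (hω : 0 < ω) (hs : 0 < s) (hτ : 0 ≤ τ) :
    !₂[0, -(s / 2)] ∈ trapezoid ω s τ := by
  simp [trapezoid]
  constructor <;> linarith

lemma base_right_mem_trapezoid {ω s τ : ℝ} (hω : 0 < ω) (hs : 0 < s) (hτ : 0 ≤ τ) :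
    !₂[0, s / 2] ∈ trapezoid ω s τ := by
  simp [trapezoid]
  refine ⟨?_, ?_, ?_⟩ <;> linarith

lemma apex_mem_trapezoid {ω s τ : ℝ} (hω : 0 < ω) (hτ : 0 ≤ τ) :
    !₂[ω, 0] ∈ trapezoid ω s τ := by
  simp [trapezoid, hω.ne', hω.le, hτ]

lemma cross_trapezoid (ω s : ℝ) :
    cross ((!₂[0, s / 2] : Plane) - !₂[0, -(s / 2)]) (!₂[ω, 0] - !₂[0, -(s / 2)]) = -(s * ω) := by
  simp [cross]

lemma norm_base_trapezoid {s : ℝ} (hs : 0 ≤ s) :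
    ‖(!₂[0, s / 2] : Plane) - !₂[0, -(s / 2)]‖ = s := by
  rw [← sq_eq_sq₀ (norm_nonneg _) hs, norm_sq_eq_coord]
  simp

lemma norm_leg_right_trapezoid {ω s l : ℝ} (hl : 0 ≤ l) (h : l ^ 2 = ω ^ 2 + (s / 2) ^ 2) :
    ‖(!₂[0, s / 2] : Plane) - !₂[ω, 0]‖ = l := by
  rw [← sq_eq_sq₀ (norm_nonneg _) hl, norm_sq_eq_coord, h]
  simp

lemma norm_leg_left_trapezoid {ω s l : ℝ} (hl : 0 ≤ l) (h : l ^ 2 = ω ^ 2 + (s / 2) ^ 2) :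
    ‖(!₂[ω, 0] : Plane) - !₂[0, -(s / 2)]‖ = l := by
  rw [← sq_eq_sq₀ (norm_nonneg _) hl, norm_sq_eq_coord, h]
  simp

/-- The incircle of the triangle with base `s` and legs `l`: barycentric weights of the incentre are
proportional to the opposite sides. -/
lemma exists_closedBall_subset_trapezoid {ω s τ l : ℝ} (hω : 0 < ω) (hs : 0 < s) (hτ : 0 ≤ τ)
    (hl : 0 < l) (h : l ^ 2 = ω ^ 2 + (s / 2) ^ 2) :
    ∃ x, closedBall x (s * ω / (s + 2 * l)) ⊆ trapezoid ω s τ := by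
  have hcr := cross_trapezoid ω s
  have habs : |-(s * ω)| = s * ω := by rw [abs_neg, abs_of_pos (by positivity)]
  refine ⟨_, closedBall_subset_of_barycentric (convex_trapezoid ω s τ)
    (base_left_mem_trapezoid hω hs hτ) (base_right_mem_trapezoid hω hs hτ)
    (apex_mem_trapezoid hω hτ) (α := l / (s + 2 * l)) (β := l / (s + 2 * l))
    (γ := s / (s + 2 * l)) (by field_simp; ring) ?_ ?_ ?_ ?_⟩
  · rw [hcr]
    exact neg_ne_zero.2 (by positivity)
  · rw [hcr, habs, norm_leg_right_trapezoid hl.le h]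
    exact le_of_eq (by ring)
  · rw [hcr, habs, norm_leg_left_trapezoid hl.le h]
    exact le_of_eq (by ring)
  · rw [hcr, habs, norm_base_trapezoid hs.le]
    exact le_of_eq (by ring)

lemma trapezoid_mem_convexBodies {ω s τ : ℝ} (hω : 0 < ω) (hs : 0 < s) (hτ : 0 ≤ τ) :
    trapezoid ω s τ ∈ convexBodies := by
  have hp : 0 < ω ^ 2 + (s / 2) ^ 2 := by positivity
  obtain ⟨x, hx⟩ := exists_closedBall_subset_trapezoid hω hs hτ (Real.sqrt_pos.2 hp)
    (Real.sq_sqrt hp.le)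
  have := Real.sqrt_pos.2 hp
  exact mem_convexBodies_of_closedBall_subset (isCompact_trapezoid hω hs)
    (convex_trapezoid ω s τ) (by positivity) hx

/-- When `l ≤ s` the base is the longest side of the triangle, so the height `ω` on it is the
triangle's width; widening along the base stays in the same strip. -/
lemma minimalWidth_trapezoid {ω s τ l : ℝ} (hω : 0 < ω) (hs : 0 < s) (hτ : 0 ≤ τ) (hl : 0 < l)
    (h : l ^ 2 = ω ^ 2 + (s / 2) ^ 2) (hls : l ≤ s) : minimalWidth (trapezoid ω s τ) = ω := by
  have hK := trapezoid_mem_convexBodies hω hs hτ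
  apply le_antisymm
  · refine minimalWidth_le hK (u := EuclideanSpace.single 0 1) (by simp) fun x hx y hy => ?_
    have h1 := hx.2.1
    have h2 := hy.1
    rw [inner_eq_coord]
    simp
    linarith
  · refine le_minimalWidth_of_triangle hK (base_left_mem_trapezoid hω hs hτ)
      (base_right_mem_trapezoid hω hs hτ) (apex_mem_trapezoid hω hτ) hs
      (norm_base_trapezoid hs.le).le ?_ ?_ ?_
    · rw [norm_sub_rev, norm_leg_right_trapezoid hl.le h]; exact hls
    · rw [norm_sub_rev, norm_leg_left_trapezoid hl.le h]; exact hls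
    · rw [cross_trapezoid, abs_neg, abs_of_pos (by positivity), mul_comm]

lemma inradius_trapezoid_zero {ω s l : ℝ} (hω : 0 < ω) (hs : 0 < s) (hl : 0 < l)
    (h : l ^ 2 = ω ^ 2 + (s / 2) ^ 2) : inradius (trapezoid ω s 0) = s * ω / (s + 2 * l) := by
  obtain ⟨x, hx⟩ := exists_closedBall_subset_trapezoid hω hs le_rfl hl h
  refine inradius_eq (trapezoid_mem_convexBodies hω hs le_rfl) (by positivity) hx
    fun y ρ hρ hy => ?_
  have hmem : ∀ v : Plane, ‖v‖ = 1 → y + ρ • v ∈ trapezoid ω s 0 := fun v hv => hy (by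
    rw [mem_closedBall, dist_eq_norm, add_sub_cancel_left, norm_smul, hv, mul_one,
      Real.norm_eq_abs, abs_of_nonneg hρ])
  have hunit : ∀ a b : ℝ, a ^ 2 + b ^ 2 = 1 → ‖(!₂[a, b] : Plane)‖ = 1 := fun a b hab => by
    rw [← sq_eq_sq₀ (norm_nonneg _) zero_le_one, norm_sq_eq_coord, one_pow]
    simpa using hab
  have h1 := (hmem !₂[-1, 0] (hunit _ _ (by norm_num))).1
  -- The vectors tested are the outward unit normals of the three sides; the three constraints,
  -- weighted by side lengths, sum to the bound on `ρ`.
  have hn : (s / (2 * l)) ^ 2 + (ω / l) ^ 2 = 1 := by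
    field_simp
    nlinarith
  have h2 := (hmem !₂[s / (2 * l), ω / l] (hunit _ _ hn)).2.2.2
  have h3 := (hmem !₂[s / (2 * l), -(ω / l)] (hunit _ _ (by rw [neg_sq]; exact hn))).2.2.1
  simp at h1 h2 h3
  rw [le_div_iff₀ (by positivity)]
  have e1 : ω * (ω / l) + s / 2 * (s / (2 * l)) = l := by
    field_simp
    nlinarith
  have e2 : ω * (s / 2 * (1 - (y 0 + ρ * (s / (2 * l))) / ω))
      = s / 2 * (ω - (y 0 + ρ * (s / (2 * l)))) := by field_simp
  have h2' := mul_le_mul_of_nonneg_left h2 hω.le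
  have h3' := mul_le_mul_of_nonneg_left h3 hω.le
  nlinarith

/-! ### Areas of trapezoids; bodies with given width and area or inradius -/

lemma volume_eq_lintegral (S : Set Plane) (hS : MeasurableSet S) :
    volume S = ∫⁻ a, volume {b : ℝ | !₂[a, b] ∈ S} := by
  have h1 := (PiLp.volume_preserving_toLp (Fin 2)).measure_preimage hS.nullMeasurableSet
  have h2 := (volume_preserving_finTwoArrow ℝ).symm.measure_preimage
    ((PiLp.volume_preserving_toLp (Fin 2)).measurable hS).nullMeasurableSet
  rw [← h1, ← h2, Measure.volume_eq_prod, Measure.prod_apply]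
  · rfl
  · exact (volume_preserving_finTwoArrow ℝ).symm.measurable
      ((PiLp.volume_preserving_toLp (Fin 2)).measurable hS)

lemma volume_trapezoid {ω s τ : ℝ} (hω : 0 < ω) (hs : 0 < s) (hτ : 0 ≤ τ) :
    volume (trapezoid ω s τ) = ENNReal.ofReal (s * ω / 2 + τ * ω) := by
  rw [volume_eq_lintegral _ (isClosed_trapezoid ω s τ).measurableSet]
  have e : ∀ a : ℝ, volume {b : ℝ | !₂[a, b] ∈ trapezoid ω s τ}
      = (Icc 0 ω).indicator (fun a => ENNReal.ofReal (s * (1 - a / ω) + τ)) a := by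
    intro a
    by_cases ha : a ∈ Icc 0 ω
    · rw [indicator_of_mem ha]
      have : {b : ℝ | !₂[a, b] ∈ trapezoid ω s τ}
          = Icc (-(s / 2 * (1 - a / ω))) (s / 2 * (1 - a / ω) + τ) := by
        ext b
        simp [trapezoid, ha.1, ha.2]
      rw [this, Real.volume_Icc]
      congr 1
      ring
    · rw [indicator_of_notMem ha]
      have : {b : ℝ | !₂[a, b] ∈ trapezoid ω s τ} = ∅ := by
        ext b
        simp only [trapezoid, mem_ofPred_eq, mem_empty_iff_false, iff_false]
        exact fun h => ha ⟨h.1, h.2.1⟩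
      rw [this, measure_empty]
  simp only [e]
  rw [lintegral_indicator measurableSet_Icc, ← ofReal_integral_eq_lintegral_ofReal]
  · congr 1
    rw [integral_Icc_eq_integral_Ioc, ← intervalIntegral.integral_of_le hω.le]
    have : ∀ a : ℝ, HasDerivAt (fun a => s * (a - a ^ 2 / (2 * ω)) + τ * a)
        (s * (1 - a / ω) + τ) a := by
      intro a
      have h1 := (((hasDerivAt_id a).sub (((hasDerivAt_pow 2 a)).div_const (2 * ω))).const_mul s).add
        ((hasDerivAt_id a).const_mul τ)
      refine h1.congr_deriv ?_
      field_simp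
      ring
    rw [intervalIntegral.integral_eq_sub_of_hasDerivAt (fun a _ => this a)
      (Continuous.intervalIntegrable (by fun_prop) _ _)]
    field_simp
    ring
  · exact (Continuous.integrableOn_Icc (by fun_prop))
  · refine (ae_restrict_iff' measurableSet_Icc).2 (Eventually.of_forall fun a ha => ?_)
    have : a / ω ≤ 1 := (div_le_one hω).2 ha.2
    have : 0 ≤ s * (1 - a / ω) := mul_nonneg hs.le (by linarith)
    show 0 ≤ s * (1 - a / ω) + τ
    linarith

/-- Start from the equilateral triangle of height `ω`, of area `ω ^ 2 / √3`; widening by `τ` adds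
area `τ ω` at constant width. -/
lemma exists_minimalWidth_volume_eq {ω A : ℝ} (hω : 0 < ω) (h : ω ^ 2 ≤ √3 * A) :
    ∃ Ω ∈ convexBodies, minimalWidth Ω = ω ∧ volume Ω = ENNReal.ofReal A := by
  have h3 : √3 ^ 2 = 3 := Real.sq_sqrt (by norm_num)
  have h3' : 0 < √3 := by positivity
  have hs : 0 < 2 * ω / √3 := by positivity
  have hτ : 0 ≤ (A - ω ^ 2 / √3) / ω := by
    apply div_nonneg _ hω.le
    rw [sub_nonneg, div_le_iff₀ h3']
    linarith
  refine ⟨trapezoid ω (2 * ω / √3) ((A - ω ^ 2 / √3) / ω), trapezoid_mem_convexBodies hω hs hτ,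
    minimalWidth_trapezoid hω hs hτ hs ?_ le_rfl, ?_⟩
  · field_simp
    rw [h3]
    norm_num
  · rw [volume_trapezoid hω hs hτ]
    congr 1
    field_simp
    ring

/-- Solving `s ω / (s + 2 l) = r` together with `l ^ 2 = ω ^ 2 + (s / 2) ^ 2` gives the base and
legs below; `l ≤ s` then amounts to `ω ≤ 3 r`. -/
lemma exists_minimalWidth_inradius_eq {ω r : ℝ} (hr : 0 < r) (h : 2 * r < ω) (h' : ω ≤ 3 * r) :
    ∃ Ω ∈ convexBodies, minimalWidth Ω = ω ∧ inradius Ω = r := by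
  have hω : 0 < ω := by linarith
  have hp : 0 < ω * (ω - 2 * r) := mul_pos hω (by linarith)
  have hq := Real.sq_sqrt hp.le
  have hq0 := Real.sqrt_pos.2 hp
  set q := √(ω * (ω - 2 * r))
  have hs : 0 < 2 * ω * r / q := by positivity
  have hl : 0 < ω * (ω - r) / q := div_pos (mul_pos hω (by linarith)) hq0
  have hsq : (ω * (ω - r) / q) ^ 2 = ω ^ 2 + (2 * ω * r / q / 2) ^ 2 := by
    field_simp
    rw [hq]
    ring
  refine ⟨trapezoid ω (2 * ω * r / q) 0, trapezoid_mem_convexBodies hω hs le_rfl,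
    minimalWidth_trapezoid hω hs le_rfl hl hsq ?_, ?_⟩
  · apply div_le_div_of_nonneg_right _ hq0.le
    nlinarith
  · have e : 2 * ω * r / q + 2 * (ω * (ω - r) / q) = 2 * ω ^ 2 / q := by ring
    rw [inradius_trapezoid_zero hω hs hl hsq, e]
    field_simp

/-! ### Isosceles triangles inscribed in a circle -/

lemma exists_circumradius_diam_eq {R d : ℝ} (hR : 0 < R) (h : √3 * R ≤ d) (h' : d < 2 * R) :
    ∃ Ω ∈ convexBodies, circumradius Ω = R ∧ diam Ω = d := by
  have h3 : √3 ^ 2 = 3 := Real.sq_sqrt (by norm_num)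
  have h30 : 0 < √3 := by positivity
  have hd : 0 < d := (mul_pos h30 hR).trans_le h
  have hd3 : 3 * R ^ 2 ≤ d ^ 2 := by nlinarith [mul_pos h30 hR]
  -- The base is at height `-y` and the apex at `(0, R)` on the circle of radius `R`, so the legs
  -- have squared length `2R (R + y)`. The lower bound on `d` gives `y ≥ R / 2`, which makes the
  -- base at most `d`; `d < 2R` gives `y < R`.
  obtain ⟨y, hy⟩ : ∃ y, d ^ 2 = 2 * R * (R + y) := ⟨d ^ 2 / (2 * R) - R, by field_simp; ring⟩
  have hy1 : R ≤ 2 * y := by nlinarith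
  have hy2 : y < R := by nlinarith
  have hx0 : 0 < R ^ 2 - y ^ 2 := by nlinarith
  obtain ⟨x, hx, hxy⟩ : ∃ x, 0 < x ∧ x ^ 2 + y ^ 2 = R ^ 2 :=
    ⟨√(R ^ 2 - y ^ 2), Real.sqrt_pos.2 hx0, by rw [Real.sq_sqrt hx0.le]; ring⟩
  set a : Plane := !₂[-x, -y] with ha
  set b : Plane := !₂[x, -y] with hb
  set c : Plane := !₂[0, R] with hc
  have hca : ‖c - a‖ = d := by
    rw [← sq_eq_sq₀ (norm_nonneg _) hd.le, norm_sq_eq_coord]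
    simp [ha, hc]
    nlinarith
  have hbc : ‖b - c‖ = d := by
    rw [← sq_eq_sq₀ (norm_nonneg _) hd.le, norm_sq_eq_coord]
    simp [hb, hc]
    nlinarith
  have hba : ‖b - a‖ ≤ d := by
    apply abs_le_of_sq_le_sq' _ hd.le |>.2
    rw [norm_sq_eq_coord]
    simp [ha, hb]
    nlinarith
  have hmem : ∀ z ∈ ({a, b, c} : Set Plane), z ∈ convexHull ℝ {a, b, c} := fun z hz =>
    subset_convexHull ℝ _ hz
  have hcr : cross (b - a) (c - a) = 2 * x * (R + y) := by
    simp [cross, ha, hb, hc]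
    left
    ring
  have hcr0 : 0 < cross (b - a) (c - a) := by rw [hcr]; nlinarith [mul_pos hx hR]
  have hρ : 0 < cross (b - a) (c - a) / (3 * d) := by positivity
  have hside : ∀ w : Plane, ‖w‖ ≤ d →
      cross (b - a) (c - a) / (3 * d) * ‖w‖ ≤ 1 / 3 * |cross (b - a) (c - a)| := by
    intro w hw
    rw [abs_of_pos hcr0]
    calc cross (b - a) (c - a) / (3 * d) * ‖w‖ ≤ cross (b - a) (c - a) / (3 * d) * d := by gcongr
      _ = 1 / 3 * cross (b - a) (c - a) := by field_simp
  have hball := closedBall_subset_of_barycentric (convex_convexHull ℝ {a, b, c})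
    (hmem a (by simp)) (hmem b (by simp)) (hmem c (by simp)) (α := 1 / 3) (β := 1 / 3)
    (γ := 1 / 3) (by norm_num) hcr0.ne' (hside _ hbc.le) (hside _ hca.le) (hside _ hba)
  have hcomp : IsCompact (convexHull ℝ {a, b, c}) := (toFinite {a, b, c}).isCompact_convexHull ℝ
  have hK := mem_convexBodies_of_closedBall_subset hcomp (convex_convexHull ℝ _) hρ hball
  refine ⟨_, hK, ?_, ?_⟩
  · refine circumradius_eq hK (x := 0) (convexHull_min ?_ (convex_closedBall 0 R)) fun z ρ hz => ?_
    · have hn : ∀ w : Plane, w 0 ^ 2 + w 1 ^ 2 = R ^ 2 → w ∈ closedBall (0 : Plane) R := by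
        intro w hw
        rw [mem_closedBall_zero_iff]
        rw [← norm_sq_eq_coord] at hw
        exact (abs_le_of_sq_le_sq' hw.le hR.le).2
      rintro w (rfl | rfl | rfl)
      · exact hn _ (by simp [ha, hxy])
      · exact hn _ (by simp [hb, hxy])
      · exact hn _ (by simp [hc])
    -- The circle's centre lies in the triangle, so any other centre `z` makes a nonpositive inner
    -- product with some vertex, and that vertex is at distance at least `R` from `z`.
    · have hfar : ∀ w ∈ ({a, b, c} : Set Plane), w 0 ^ 2 + w 1 ^ 2 = R ^ 2 → inner ℝ w z ≤ 0 →
          R ≤ ρ := by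
        intro w hw h1 h2
        have h3 := hz (hmem w hw)
        rw [mem_closedBall, dist_eq_norm] at h3
        refine le_trans ?_ h3
        apply abs_le_of_sq_le_sq' _ (norm_nonneg _) |>.2
        rw [← norm_sq_eq_coord] at h1
        rw [norm_sub_sq_real, h1]
        nlinarith [sq_nonneg ‖z‖]
      rcases le_total (z 1) 0 with h1 | h1
      · refine hfar c (by simp) (by simp [hc]) ?_
        rw [inner_eq_coord]
        simp [hc]
        nlinarith
      · rcases le_total (z 0) 0 with h2 | h2
        · refine hfar b (by simp) (by simp [hb, hxy]) ?_
          rw [inner_eq_coord]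
          simp [hb]
          nlinarith
        · refine hfar a (by simp) (by simp [ha, hxy]) ?_
          rw [inner_eq_coord]
          simp [ha]
          nlinarith
  · rw [convexHull_diam]
    apply le_antisymm
    · refine diam_le_of_forall_dist_le hd.le ?_
      rintro p (rfl | rfl | rfl) q (rfl | rfl | rfl) <;> rw [dist_eq_norm] <;>
        first
        | (rw [sub_self, norm_zero]; exact hd.le)
        | assumption
        | (rw [norm_sub_rev]; assumption)
        | exact hbc.le
        | exact hca.le
        | (rw [norm_sub_rev]; exact hbc.le)
        | (rw [norm_sub_rev]; exact hca.le)
    · rw [← hca, ← dist_eq_norm]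
      exact dist_le_diam_of_mem (toFinite _).isBounded (by simp) (by simp)

/-! ### Level sets of shape functionals -/

/-- A property that, on convex bodies, prescribes the value of a homogeneous monotone functional. -/
def IsLevel (p : Set Plane → Prop) : Prop :=
  ∃ (k : ℕ) (F : Set Plane → ENNReal) (a : ENNReal),
    HomogeneousMonotone k F ∧ ∀ Ω ∈ convexBodies, p Ω ↔ F Ω = a

lemma isLevel_of_real {k : ℕ} {f : Set Plane → ℝ}
    (hf : HomogeneousMonotone k fun Ω => ENNReal.ofReal (f Ω))
    (h0 : ∀ Ω ∈ convexBodies, 0 ≤ f Ω) {a : ℝ} (ha : 0 ≤ a) : IsLevel fun Ω => f Ω = a :=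
  ⟨k, _, ENNReal.ofReal a, hf, fun Ω hΩ => (ENNReal.ofReal_eq_ofReal_iff (h0 Ω hΩ) ha).symm⟩

lemma isLevel_diam {d : ℝ} (hd : 0 ≤ d) : IsLevel fun Ω => diam Ω = d :=
  isLevel_of_real homogeneousMonotone_diam (fun _ _ => diam_nonneg) hd

lemma isLevel_inradius {r : ℝ} (hr : 0 ≤ r) : IsLevel fun Ω => inradius Ω = r :=
  isLevel_of_real homogeneousMonotone_inradius (fun Ω _ => inradius_nonneg Ω) hr

lemma isLevel_circumradius {R : ℝ} (hR : 0 ≤ R) : IsLevel fun Ω => circumradius Ω = R :=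
  isLevel_of_real homogeneousMonotone_circumradius (fun Ω _ => circumradius_nonneg Ω) hR

lemma isLevel_minimalWidth {ω : ℝ} (hω : 0 ≤ ω) : IsLevel fun Ω => minimalWidth Ω = ω :=
  isLevel_of_real homogeneousMonotone_minimalWidth (fun _ hΩ => minimalWidth_nonneg hΩ) hω

lemma isLevel_perimeter (a : ENNReal) : IsLevel fun Ω => perimeter Ω = a :=
  ⟨1, _, a, homogeneousMonotone_perimeter, fun _ _ => Iff.rfl⟩

lemma isLevel_volume (a : ENNReal) : IsLevel fun Ω => volume Ω = a :=
  ⟨2, _, a, homogeneousMonotone_volume, fun _ _ => Iff.rfl⟩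

theorem cheegerAttainsMinAndMax_of_isLevel {p q : Set Plane → Prop} (hp : IsLevel p)
    (hq : IsLevel q) (ρ M : ℝ) (hρ : 0 < ρ)
    (hne : ∃ Ω ∈ convexBodies, p Ω ∧ q Ω)
    (hbd : ∀ Ω ∈ convexBodies, p Ω → q Ω → (∃ x, closedBall x ρ ⊆ Ω) ∧ diam Ω ≤ M) :
    CheegerAttainsMinAndMax {Ω ∈ convexBodies | p Ω ∧ q Ω} := by
  obtain ⟨k, F, a, hF, hpF⟩ := hp
  obtain ⟨l, G, b, hG, hqG⟩ := hq
  have e : {Ω ∈ convexBodies | p Ω ∧ q Ω} = {Ω ∈ convexBodies | F Ω = a ∧ G Ω = b} := by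
    ext Ω
    exact and_congr_right fun hΩ => and_congr (hpF Ω hΩ) (hqG Ω hΩ)
  rw [e]
  refine cheegerAttainsMinAndMax_of_bounds hF hG hρ
    (fun Ω hΩ h1 h2 => hbd Ω hΩ ((hpF Ω hΩ).2 h1) ((hqG Ω hΩ).2 h2)) ?_
  obtain ⟨Ω, hΩ, h1, h2⟩ := hne
  exact ⟨Ω, hΩ, (hpF Ω hΩ).1 h1, (hqG Ω hΩ).1 h2⟩

lemma exists_closedBall_of_inradius_eq {Ω : Set Plane} (hΩ : Ω ∈ convexBodies) {r : ℝ}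
    (h : inradius Ω = r) : ∃ x, closedBall x r ⊆ Ω :=
  h ▸ exists_closedBall_inradius hΩ

lemma exists_closedBall_of_minimalWidth_eq {Ω : Set Plane} (hΩ : Ω ∈ convexBodies) {ω : ℝ}
    (hω : 0 < ω) (h : minimalWidth Ω = ω) : ∃ x, closedBall x (ω / 9) ⊆ Ω := by
  subst h
  exact exists_closedBall_of_minimalWidth hΩ hω

end PlanarCheeger


/-! ### The thirteen classes -/

open PlanarCheeger in
theorem theorem1p1 :
    (∀ P r : ℝ, 0 < r → 2 * Real.pi * r ≤ P →
      CheegerAttainsMinAndMax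
        {Ω ∈ convexBodies | perimeter Ω = ENNReal.ofReal P ∧ inradius Ω = r}) ∧
    (∀ d r : ℝ, 0 < r → 2 * r ≤ d →
      CheegerAttainsMinAndMax
        {Ω ∈ convexBodies | Metric.diam Ω = d ∧ inradius Ω = r}) ∧
    (∀ R r : ℝ, 0 < r → r ≤ R →
      CheegerAttainsMinAndMax
        {Ω ∈ convexBodies | circumradius Ω = R ∧ inradius Ω = r}) ∧
    (∀ ω d : ℝ, 0 < ω → ω ≤ d →
      CheegerAttainsMinAndMax
        {Ω ∈ convexBodies | minimalWidth Ω = ω ∧ Metric.diam Ω = d}) ∧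
    (∀ ω R : ℝ, 0 < ω → ω ≤ 2 * R →
      CheegerAttainsMinAndMax
        {Ω ∈ convexBodies | minimalWidth Ω = ω ∧ circumradius Ω = R}) ∧
    (∀ ω P : ℝ, 0 < ω → Real.pi * ω ≤ P →
      CheegerAttainsMinAndMax
        {Ω ∈ convexBodies | minimalWidth Ω = ω ∧ perimeter Ω = ENNReal.ofReal P}) ∧
    (∀ ω A : ℝ, 0 < ω → ω ^ 2 ≤ Real.sqrt 3 * A →
      CheegerAttainsMinAndMax
        {Ω ∈ convexBodies | minimalWidth Ω = ω ∧ MeasureTheory.volume Ω = ENNReal.ofReal A}) ∧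
    (∀ R d : ℝ, 0 < R → Real.sqrt 3 * R ≤ d → d < 2 * R →
      CheegerAttainsMinAndMax
        {Ω ∈ convexBodies | circumradius Ω = R ∧ Metric.diam Ω = d}) ∧
    (∀ ω r : ℝ, 0 < r → 2 * r < ω → ω ≤ 3 * r →
      CheegerAttainsMinAndMax
        {Ω ∈ convexBodies | minimalWidth Ω = ω ∧ inradius Ω = r}) ∧
    (∀ R A : ℝ, 0 < R → 0 < A → A ≤ Real.pi * R ^ 2 →
      CheegerAttainsMinAndMax
        {Ω ∈ convexBodies | circumradius Ω = R ∧ MeasureTheory.volume Ω = ENNReal.ofReal A}) ∧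
    (∀ P R : ℝ, 0 < R → 4 * R < P → P ≤ 2 * Real.pi * R →
      CheegerAttainsMinAndMax
        {Ω ∈ convexBodies | perimeter Ω = ENNReal.ofReal P ∧ circumradius Ω = R}) ∧
    (∀ P d : ℝ, 0 < d → 2 * d < P → P ≤ Real.pi * d →
      CheegerAttainsMinAndMax
        {Ω ∈ convexBodies | perimeter Ω = ENNReal.ofReal P ∧ Metric.diam Ω = d}) ∧
    (∀ d A : ℝ, 0 < d → 0 < A → 4 * A ≤ Real.pi * d ^ 2 →
      CheegerAttainsMinAndMax
        {Ω ∈ convexBodies | Metric.diam Ω = d ∧ MeasureTheory.volume Ω = ENNReal.ofReal A}) := by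
  refine ⟨?_, ?_, ?_, ?_, ?_, ?_, ?_, ?_, ?_, ?_, ?_, ?_, ?_⟩
  · intro P r hr h
    have hP : 0 ≤ P := le_trans (by positivity) h
    refine cheegerAttainsMinAndMax_of_isLevel (isLevel_perimeter _) (isLevel_inradius hr.le)
      r (8 * P) hr ?_ fun Ω hΩ h1 h2 => ?_
    · obtain ⟨ρ, hρ, e⟩ := exists_barrel_perimeter_eq_of_halfWidth hr h
      exact ⟨_, barrel_mem_convexBodies hr hρ, e, inradius_barrel hr hρ⟩
    · obtain ⟨x, hx⟩ := exists_closedBall_of_inradius_eq hΩ h2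
      exact ⟨⟨x, hx⟩, diam_le_of_perimeter hΩ hr hP hx h1⟩
  · intro d r hr h
    have hrd : r ≤ d / 2 := by linarith
    refine cheegerAttainsMinAndMax_of_isLevel (isLevel_diam (by linarith)) (isLevel_inradius hr.le)
      r d hr ?_ fun Ω hΩ h1 h2 => ⟨exists_closedBall_of_inradius_eq hΩ h2, h1.le⟩
    exact ⟨_, barrel_mem_convexBodies hr hrd, by rw [diam_barrel hr hrd]; ring,
      inradius_barrel hr hrd⟩
  · intro R r hr h
    refine cheegerAttainsMinAndMax_of_isLevel (isLevel_circumradius (by linarith))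
      (isLevel_inradius hr.le) r (2 * R) hr ?_ fun Ω hΩ h1 h2 =>
        ⟨exists_closedBall_of_inradius_eq hΩ h2, h1 ▸ diam_le_two_mul_circumradius hΩ⟩
    exact ⟨_, barrel_mem_convexBodies hr h, circumradius_barrel hr h, inradius_barrel hr h⟩
  · intro ω d hω h
    have hω' : 0 < ω / 2 := by positivity
    have hωd : ω / 2 ≤ d / 2 := by linarith
    refine cheegerAttainsMinAndMax_of_isLevel (isLevel_minimalWidth hω.le)
      (isLevel_diam (by linarith)) (ω / 9) d (by positivity) ?_ fun Ω hΩ h1 h2 =>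
        ⟨exists_closedBall_of_minimalWidth_eq hΩ hω h1, h2.le⟩
    exact ⟨_, barrel_mem_convexBodies hω' hωd, by rw [minimalWidth_barrel hω' hωd]; ring,
      by rw [diam_barrel hω' hωd]; ring⟩
  · intro ω R hω h
    have hω' : 0 < ω / 2 := by positivity
    have hωR : ω / 2 ≤ R := by linarith
    refine cheegerAttainsMinAndMax_of_isLevel (isLevel_minimalWidth hω.le)
      (isLevel_circumradius (by linarith)) (ω / 9) (2 * R) (by positivity) ?_ fun Ω hΩ h1 h2 =>
        ⟨exists_closedBall_of_minimalWidth_eq hΩ hω h1, h2 ▸ diam_le_two_mul_circumradius hΩ⟩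
    exact ⟨_, barrel_mem_convexBodies hω' hωR, by rw [minimalWidth_barrel hω' hωR]; ring,
      circumradius_barrel hω' hωR⟩
  · intro ω P hω h
    have hω' : 0 < ω / 2 := by positivity
    have hP : 0 ≤ P := le_trans (by positivity) h
    refine cheegerAttainsMinAndMax_of_isLevel (isLevel_minimalWidth hω.le)
      (isLevel_perimeter _) (ω / 9) (8 * P) (by positivity) ?_ fun Ω hΩ h1 h2 => ?_
    · obtain ⟨ρ, hρ, e⟩ := exists_barrel_perimeter_eq_of_halfWidth (P := P) hω' (by linarith)
      exact ⟨_, barrel_mem_convexBodies hω' hρ, by rw [minimalWidth_barrel hω' hρ]; ring, e⟩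
    · obtain ⟨x, hx⟩ := exists_closedBall_of_minimalWidth_eq hΩ hω h1
      exact ⟨⟨x, hx⟩, diam_le_of_perimeter hΩ (by positivity) hP hx h2⟩
  · intro ω A hω h
    have hA : 0 ≤ A := by
      by_contra! hA
      nlinarith [Real.sqrt_nonneg 3, sq_pos_of_pos hω]
    refine cheegerAttainsMinAndMax_of_isLevel (isLevel_minimalWidth hω.le)
      (isLevel_volume _) (ω / 9) (4 * A / (ω / 9)) (by positivity)
      (exists_minimalWidth_volume_eq hω h) fun Ω hΩ h1 h2 => ?_
    obtain ⟨x, hx⟩ := exists_closedBall_of_minimalWidth_eq hΩ hω h1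
    exact ⟨⟨x, hx⟩, diam_le_of_volume hΩ (by positivity) hA hx h2⟩
  · intro R d hR h h'
    have hd : 0 ≤ d := le_trans (by positivity) h
    have hpos : 0 < R ^ 2 - (d / 2) ^ 2 := by nlinarith
    refine cheegerAttainsMinAndMax_of_isLevel (isLevel_circumradius hR.le) (isLevel_diam hd)
      (√(R ^ 2 - (d / 2) ^ 2) / 6) d (by positivity) (exists_circumradius_diam_eq hR h h')
      fun Ω hΩ h1 h2 => ⟨?_, h2.le⟩
    subst h1 h2
    exact exists_closedBall_of_circumradius hΩ h'
  · intro ω r hr h h'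
    -- The diameter bound uses the midpoint of `r` and `ω / 2` as a radius strictly between them.
    refine cheegerAttainsMinAndMax_of_isLevel (isLevel_minimalWidth (by linarith))
      (isLevel_inradius hr.le) r
      (ω + 2 * (3 * ((r + ω / 2) / 2) * ω / (ω - 2 * ((r + ω / 2) / 2)))) hr
      (exists_minimalWidth_inradius_eq hr h h')
      fun Ω hΩ h1 h2 => ⟨exists_closedBall_of_inradius_eq hΩ h2, ?_⟩
    subst h1 h2
    exact diam_le_of_inradius_lt hΩ (by linarith) (by linarith)
  · intro R A hR hA h
    refine cheegerAttainsMinAndMax_of_isLevel (isLevel_circumradius hR.le) (isLevel_volume _)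
      (A / (12 * (2 * R))) (2 * R) (by positivity) ?_ fun Ω hΩ h1 h2 => ?_
    · obtain ⟨s, hs, hsR, e⟩ := exists_barrel_volume_eq hR hA h
      exact ⟨_, barrel_mem_convexBodies hs hsR, circumradius_barrel hs hsR, e⟩
    · have hd : Metric.diam Ω ≤ 2 * R := h1 ▸ diam_le_two_mul_circumradius hΩ
      exact ⟨exists_closedBall_of_volume hΩ hA (by positivity) h2 hd, hd⟩
  · intro P R hR h h'
    refine cheegerAttainsMinAndMax_of_isLevel (isLevel_perimeter _) (isLevel_circumradius hR.le)
      ((P - 2 * (2 * R)) / 24) (2 * R) (by linarith) ?_ fun Ω hΩ h1 h2 => ?_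
    · obtain ⟨s, hs, hsR, e⟩ := exists_barrel_perimeter_eq_of_radius hR h h'
      exact ⟨_, barrel_mem_convexBodies hs hsR, e, circumradius_barrel hs hsR⟩
    · have hd : Metric.diam Ω ≤ 2 * R := h2 ▸ diam_le_two_mul_circumradius hΩ
      exact ⟨exists_closedBall_of_perimeter hΩ (by linarith) h1 hd, hd⟩
  · intro P d hd h h'
    refine cheegerAttainsMinAndMax_of_isLevel (isLevel_perimeter _) (isLevel_diam hd.le)
      ((P - 2 * d) / 24) d (by linarith) ?_ fun Ω hΩ h1 h2 =>
        ⟨exists_closedBall_of_perimeter hΩ h h1 h2.le, h2.le⟩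
    obtain ⟨s, hs, hsR, e⟩ := exists_barrel_perimeter_eq_of_radius (R := d / 2) (P := P)
      (by positivity) (by linarith) (by linarith)
    exact ⟨_, barrel_mem_convexBodies hs hsR, e, by rw [diam_barrel hs hsR]; ring⟩
  · intro d A hd hA h
    refine cheegerAttainsMinAndMax_of_isLevel (isLevel_diam hd.le) (isLevel_volume _)
      (A / (12 * d)) d (by positivity) ?_ fun Ω hΩ h1 h2 =>
        ⟨exists_closedBall_of_volume hΩ hA hd h2 h1.le, h1.le⟩
    obtain ⟨s, hs, hsR, e⟩ := exists_barrel_volume_eq (R := d / 2) (A := A) (by positivity) hA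
      (by linarith)
    exact ⟨_, barrel_mem_convexBodies hs hsR, by rw [diam_barrel hs hsR]; ring, e⟩
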